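/- Let $d\ge 1$ be an integer and $\mathbf S^d=\{x\in\mathbf R^{d+1}: |x|=1\}$. For $x,y\in\mathbf S^d$ put $\rho(x,y)=\arccos(x\cdot y)$ and $\Lambda(x,y)=\frac2\pi\min\{\rho(x,y),\pi-\rho(x,y)\}$. For $\alpha\in(0,\infty]$ and a Borel probability measure $\mu$ on $\mathbf S^d$ let $$E_\alpha(\mu)=\frac12\iint \Lambda^\alpha(x,y)\,d\mu(x)\,d\mu(y),$$ where $\Lambda^\infty(x,y)=1$ if $x\cdot y=0$ and $\Lambda^\infty(x,y)=0$ otherwise. Let $\mathcal P(\mathbf S^d)$ be the set of Borel probability measures on $\mathbf S^d$ and let $\operatorname{argmax}E_\alpha$ be the set of maximizers of $E_\alpha$ on $\mathcal P(\mathbf S^d)$. Call $\mu,\nu\in\mathcal P(\mathbf S^d)$ essentially equivalent, $\mu\equiv\nu$, if there is a rotation $M\in SO(d+1)$ such that $\mu(A\cup -A)=\nu(M(A\cup -A))$ for every open $A\subset\mathbf S^d$. Let $\mathcal P_\Delta^=(\mathbf S^d)$ be the set of all $\mu\in\mathcal P(\mathbf S^d)$ with $\mu\equiv\nu$ for some $\nu\in\mathcal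 P(\mathbf S^d)$ whose support is an orthonormal basis of $\mathbf R^{d+1}$, each of whose vectors has $\nu$-mass $\frac1{d+1}$. There is a unique $\alpha_{\Delta^d}\in[0,\infty]$ such that, for $\alpha\in(0,\infty]$, $\mathcal P_\Delta^=(\mathbf S^d)$ is disjoint from $\operatorname{argmax}E_\alpha$ whenever $\alpha<\alpha_{\Delta^d}$, and $\mathcal P_\Delta^=(\mathbf S^d)=\operatorname{argmax}E_\alpha$ whenever $\alpha>\alpha_{\Delta^d}$. This threshold exponent satisfies $$\alpha_{\Delta^d}\in[1,2).$$ Consequently there is $\varepsilon>0$ such that for every real $\alpha\in(2-\varepsilon,2)$ one has $\operatorname{argmax}E_\alpha=\mathcal P_\Delta^=(\mathbf S^d)$, this set is non-empty, and any two of its elements are essentially equivalent. -/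

import Mathlib

open MeasureTheory Set
open scoped ENNReal Pointwise

noncomputable section

namespace ProjectiveEnergy

/-- The Euclidean space of dimension `d + 1`. -/
abbrev Ambient (d : ℕ) : Type := EuclideanSpace ℝ (Fin (d + 1))

/-- The Euclidean unit sphere of dimension `d`. -/
abbrev Sph (d : ℕ) : Type := Metric.sphere (0 : Ambient d) 1

/-- The geodesic distance on the sphere. -/
def rho {d : ℕ} (x y : Sph d) : ℝ := Real.arccos (inner ℝ (x : Ambient d) (y : Ambient d))

/-- The profile `t ↦ (2 / π) min {t, π - t}`, used for `t` in `[0, π]`. -/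
def Lambda0 (t : ℝ) : ℝ := 2 / Real.pi * min t (Real.pi - t)

/-- The distance of the projective points `±x` and `±y`, rescaled to have unit diameter. -/
def Lambda {d : ℕ} (x y : Sph d) : ℝ := Lambda0 (rho x y)

open Classical in
/-- The kernel `Λ ^ α` for `α ∈ (0, ∞]`; for `α = ∞` it is `1` on orthogonal pairs and `0` on all
other pairs. -/
def kernel {d : ℕ} (α : ℝ≥0∞) (x y : Sph d) : ℝ :=
  if α = ∞ then (if inner ℝ (x : Ambient d) (y : Ambient d) = 0 then 1 else 0)
  else Lambda x y ^ α.toReal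

/-- The energy `E_α (μ) = 1/2 ∬ Λ ^ α (x, y) dμ(x) dμ(y)`. -/
def energy {d : ℕ} (α : ℝ≥0∞) (μ : ProbabilityMeasure (Sph d)) : ℝ :=
  1 / 2 * ∫ y, ∫ x, kernel α x y ∂(μ : Measure (Sph d)) ∂(μ : Measure (Sph d))

/-- The set of maximizers of `E_α` among all Borel probability measures on the sphere. -/
def argmaxEnergy (d : ℕ) (α : ℝ≥0∞) : Set (ProbabilityMeasure (Sph d)) :=
  {μ | ∀ ν : ProbabilityMeasure (Sph d), energy α ν ≤ energy α μ}

/-- The image of a subset of the sphere under a linear isometry of the ambient space. -/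
def rotate {d : ℕ} (M : Ambient d ≃ₗᵢ[ℝ] Ambient d) (A : Set (Sph d)) : Set (Sph d) :=
  {y | ∃ x ∈ A, (y : Ambient d) = M (x : Ambient d)}

/-- Essential equivalence: the projections of `μ` and `ν` to projective space are rotations of each
other. -/
def EssEquiv {d : ℕ} (μ ν : ProbabilityMeasure (Sph d)) : Prop :=
  ∃ M : Ambient d ≃ₗᵢ[ℝ] Ambient d,
    LinearMap.det (M.toLinearEquiv : Ambient d →ₗ[ℝ] Ambient d) = 1 ∧
    ∀ A : Set (Sph d), IsOpen A →
      (μ : Measure (Sph d)) (A ∪ -A) = (ν : Measure (Sph d)) (rotate M (A ∪ -A))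

/-- The probability measures whose support is an orthonormal basis of the ambient space. -/
def onMeasures (d : ℕ) : Set (ProbabilityMeasure (Sph d)) :=
  {μ | ∃ b : OrthonormalBasis (Fin (d + 1)) ℝ (Ambient d),
    (fun x : Sph d => (x : Ambient d)) '' (μ : Measure (Sph d)).support = range b}

/-- The probability measures which equidistribute their mass over an orthonormal basis. -/
def onEqMeasures (d : ℕ) : Set (ProbabilityMeasure (Sph d)) :=
  {μ | μ ∈ onMeasures d ∧ ∀ x ∈ (μ : Measure (Sph d)).support,
    (μ : Measure (Sph d)).real {x} = 1 / ((d : ℝ) + 1)}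

/-- The probability measures essentially equivalent to one which equidistributes its mass over an
orthonormal basis. -/
def simplexEqMeasures (d : ℕ) : Set (ProbabilityMeasure (Sph d)) :=
  {μ | ∃ ν ∈ onEqMeasures d, EssEquiv μ ν}

/-- `a` is a threshold exponent in dimension `d`: below `a` no measure in `simplexEqMeasures d` is a
maximizer of the energy, and above `a` the maximizers are precisely these measures. -/
def IsThresholdExponent (d : ℕ) (a : ℝ≥0∞) : Prop :=
  (∀ α : ℝ≥0∞, 0 < α → α < a → Disjoint (simplexEqMeasures d) (argmaxEnergy d α)) ∧
  (∀ α : ℝ≥0∞, a < α → simplexEqMeasures d = argmaxEnergy d α)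

end ProjectiveEnergy

end

namespace ProjectiveEnergy

open Filter Topology

noncomputable section

variable {d : ℕ}

local notation "⟪" x ", " y "⟫" => inner ℝ (Subtype.val x) (Subtype.val y)

/-! At exponent `2`, Jordan's inequality gives `Λ² ≤ 1 - ⟪x, y⟫²`, and the mean of `⟪x, y⟫²` is the
squared Hilbert–Schmidt norm of the moment matrix `∫ x xᵀ dμ`, which has trace `1`; it is therefore
at least `1 / (d + 1)` (`le_integral_inner_sq`). Hence `E_2` is at most its value on a frame.
Equality forces almost all pairs to be orthogonal or parallel, and then equal masses on the axes of
one frame (`exists_equiOn`).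

The kernel decreases in the exponent, strictly except on orthogonal or parallel pairs. So once
frames maximize at some exponent, they are exactly the maximizers at every larger one
(`SimplexMaximizes.argmax_eq`), and the threshold is an infimum.

To go below `2`, cover the frame measures by open sets `nearFrame`. On the compact complement `E_2`
stays below its maximum by a fixed gap, which survives a small change of exponent. Near a frame,
`energy_le_of_near` works for all exponents from `3 / 2` on: two points of one cell can be apart
only if they fail to be orthogonal to points of other cells. That failure costs linearly in the
cross terms, while the energy inside a small cell is a small multiple of the distance. Mass outside
the cells has too small a potential to help.

The bound `1 ≤ threshold` comes from moving mass to the midpoint of two basis vectors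
(`not_simplexMaximizes`). -/

/-! ### The projective distance as a function of the cosine. -/

lemma abs_inner_le_one (x y : Sph d) : |⟪x, y⟫| ≤ 1 := by
  have h := abs_real_inner_le_norm (x : Ambient d) (y : Ambient d)
  simpa [norm_eq_of_mem_sphere] using h

lemma inner_sq_le_one (x y : Sph d) : ⟪x, y⟫ ^ 2 ≤ 1 :=
  (sq_le_one_iff_abs_le_one _).2 (abs_inner_le_one x y)

lemma min_arccos_eq (c : ℝ) :
    min (Real.arccos c) (Real.pi - Real.arccos c) = Real.arccos |c| := by
  rw [← Real.arccos_neg]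
  rcases le_total 0 c with h | h
  · rw [abs_of_nonneg h, min_eq_left (Real.antitone_arccos (by linarith))]
  · rw [abs_of_nonpos h, min_eq_right (Real.antitone_arccos (by linarith))]

lemma Lambda_eq (x y : Sph d) : Lambda x y = 2 / Real.pi * Real.arccos |⟪x, y⟫| := by
  rw [Lambda, Lambda0, rho, min_arccos_eq]

lemma Lambda_eq_one_sub (x y : Sph d) :
    Lambda x y = 1 - 2 / Real.pi * Real.arcsin |⟪x, y⟫| := by
  rw [Lambda_eq, Real.arccos]
  have := Real.pi_ne_zero
  field_simp

lemma Lambda_nonneg (x y : Sph d) : 0 ≤ Lambda x y := by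
  rw [Lambda_eq]
  have := Real.arccos_nonneg |⟪x, y⟫|
  have := Real.pi_pos
  positivity

lemma Lambda_le_one_sub (x y : Sph d) : Lambda x y ≤ 1 - 2 / Real.pi * |⟪x, y⟫| := by
  rw [Lambda_eq_one_sub]
  have h0 := abs_nonneg ⟪x, y⟫
  have h1 := abs_inner_le_one x y
  have h : |⟪x, y⟫| ≤ Real.arcsin |⟪x, y⟫| := by
    have h2 := Real.sin_le (Real.arcsin_nonneg.2 h0)
    rwa [Real.sin_arcsin (by linarith) h1] at h2
  have := Real.pi_pos
  gcongr

lemma Lambda_le_one (x y : Sph d) : Lambda x y ≤ 1 := by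
  have h := Lambda_le_one_sub x y
  have : 0 ≤ 2 / Real.pi * |⟪x, y⟫| := by have := Real.pi_pos; positivity
  linarith

/-- Jordan's inequality `2 t / π ≤ sin t` at `t = arccos |⟪x, y⟫|`. -/
lemma Lambda_le_sqrt (x y : Sph d) : Lambda x y ≤ √(1 - ⟪x, y⟫ ^ 2) := by
  rw [Lambda_eq, ← sq_abs ⟪x, y⟫, ← Real.sin_arccos]
  exact Real.mul_le_sin (Real.arccos_nonneg _) (Real.arccos_le_pi_div_two.2 (abs_nonneg _))

lemma Lambda_sq_le (x y : Sph d) : Lambda x y ^ 2 ≤ 1 - ⟪x, y⟫ ^ 2 := by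
  have h := Lambda_le_sqrt x y
  have h1 := inner_sq_le_one x y
  calc Lambda x y ^ 2 ≤ √(1 - ⟪x, y⟫ ^ 2) ^ 2 := by
        gcongr; exact Lambda_nonneg x y
    _ = _ := Real.sq_sqrt (by linarith)

/-- The gap in Jordan's inequality, as a function of the cosine. -/
def jordanGap (t : ℝ) : ℝ := 1 - t ^ 2 - (2 / Real.pi * Real.arccos t) ^ 2

lemma jordanGap_pos {t : ℝ} (h0 : 0 < t) (h1 : t < 1) : 0 < jordanGap t := by
  have h := Real.mul_lt_sin (Real.arccos_pos.2 h1) (Real.arccos_lt_pi_div_two.2 h0)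
  rw [Real.sin_arccos] at h
  have h2 : 0 ≤ 2 / Real.pi * Real.arccos t := by
    have := Real.arccos_nonneg t
    have := Real.pi_pos
    positivity
  have h3 : (2 / Real.pi * Real.arccos t) ^ 2 < √(1 - t ^ 2) ^ 2 := by gcongr
  rw [Real.sq_sqrt (by nlinarith)] at h3
  rw [jordanGap]
  linarith

lemma jordanGap_continuous : Continuous jordanGap := by
  unfold jordanGap
  have := Real.continuous_arccos
  fun_prop

lemma Lambda_sq_eq (x y : Sph d) :
    Lambda x y ^ 2 = 1 - ⟪x, y⟫ ^ 2 - jordanGap |⟪x, y⟫| := by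
  rw [jordanGap, Lambda_eq, sq_abs]; ring

/-- The pairs of points of the sphere which are orthogonal or parallel. -/
def OrthoParallel (x y : Sph d) : Prop := ⟪x, y⟫ = 0 ∨ |⟪x, y⟫| = 1

lemma orthoParallel_of_Lambda_sq (x y : Sph d) (h : Lambda x y ^ 2 = 1 - ⟪x, y⟫ ^ 2) :
    OrthoParallel x y := by
  by_contra hc
  rw [OrthoParallel, not_or] at hc
  have := jordanGap_pos (abs_pos.2 hc.1) (lt_of_le_of_ne (abs_inner_le_one x y) hc.2)
  rw [Lambda_sq_eq] at h
  linarith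

lemma Lambda_of_inner_eq_zero {x y : Sph d} (h : ⟪x, y⟫ = 0) : Lambda x y = 1 := by
  rw [Lambda_eq_one_sub, h]; simp

lemma Lambda_of_abs_inner_eq_one {x y : Sph d} (h : |⟪x, y⟫| = 1) : Lambda x y = 0 := by
  rw [Lambda_eq, h]; simp

lemma orthoParallel_of_Lambda {x y : Sph d} (h : Lambda x y = 0 ∨ Lambda x y = 1) :
    OrthoParallel x y := by
  have hpi := Real.pi_pos
  rcases h with h | h
  · right
    rw [Lambda_eq] at h
    have : Real.arccos |⟪x, y⟫| = 0 := by
      rcases mul_eq_zero.1 h with h | h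
      · exact absurd h (by positivity)
      · exact h
    exact le_antisymm (abs_inner_le_one x y) (Real.arccos_eq_zero.1 this)
  · left
    have := Lambda_le_one_sub x y
    rw [h] at this
    have h1 : 2 / Real.pi * |⟪x, y⟫| ≤ 0 := by linarith
    have h2 : |⟪x, y⟫| ≤ 0 := by
      by_contra hc
      push Not at hc
      have : 0 < 2 / Real.pi * |⟪x, y⟫| := by positivity
      linarith
    exact abs_nonpos_iff.1 h2

lemma Lambda_continuous : Continuous fun p : Sph d × Sph d => Lambda p.1 p.2 := by
  simp_rw [Lambda_eq]
  have := Real.continuous_arccos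
  fun_prop

lemma Lambda_comm (x y : Sph d) : Lambda x y = Lambda y x := by
  rw [Lambda_eq, Lambda_eq, real_inner_comm]

/-! ### The kernel and its monotonicity in the exponent. -/

lemma kernel_comm (α : ℝ≥0∞) (x y : Sph d) : kernel α x y = kernel α y x := by
  rw [kernel, kernel, Lambda_comm, real_inner_comm]

lemma Lambda_neg (x y : Sph d) : Lambda (-x) y = Lambda x y := by
  rw [Lambda_eq, Lambda_eq]; simp

lemma kernel_neg (α : ℝ≥0∞) (x y : Sph d) : kernel α (-x) y = kernel α x y := by
  rw [kernel, kernel, Lambda_neg]; simp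

lemma kernel_nonneg (α : ℝ≥0∞) (x y : Sph d) : 0 ≤ kernel α x y := by
  rw [kernel]
  split_ifs
  · exact zero_le_one
  · exact le_rfl
  · exact Real.rpow_nonneg (Lambda_nonneg x y) _

lemma kernel_le_one (α : ℝ≥0∞) (x y : Sph d) : kernel α x y ≤ 1 := by
  rw [kernel]
  split_ifs
  · exact le_rfl
  · exact zero_le_one
  · exact Real.rpow_le_one (Lambda_nonneg x y) (Lambda_le_one x y) ENNReal.toReal_nonneg

lemma kernel_of_ne_top {α : ℝ≥0∞} (h : α ≠ ∞) (x y : Sph d) :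
    kernel α x y = Lambda x y ^ α.toReal := by simp [kernel, h]

lemma kernel_ofReal {α : ℝ} (h : 0 ≤ α) (x y : Sph d) :
    kernel (ENNReal.ofReal α) x y = Lambda x y ^ α := by
  rw [kernel_of_ne_top ENNReal.ofReal_ne_top, ENNReal.toReal_ofReal h]

lemma kernel_two (x y : Sph d) : kernel 2 x y = Lambda x y ^ 2 := by
  rw [kernel_of_ne_top (by simp)]; simp

lemma kernel_continuous {α : ℝ≥0∞} (h : α ≠ ∞) :
    Continuous fun p : Sph d × Sph d => kernel α p.1 p.2 := by
  simp_rw [kernel_of_ne_top h]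
  exact Lambda_continuous.rpow_const fun _ => Or.inr ENNReal.toReal_nonneg

lemma kernel_measurable (α : ℝ≥0∞) :
    Measurable fun p : Sph d × Sph d => kernel α p.1 p.2 := by
  by_cases h : α = ∞
  · simp_rw [kernel, if_pos h]
    refine Measurable.ite ?_ measurable_const measurable_const
    exact (isClosed_eq (f := fun p : Sph d × Sph d => ⟪p.1, p.2⟫) (by fun_prop)
      continuous_const).measurableSet
  · exact (kernel_continuous h).measurable

lemma kernel_of_inner_eq_zero (α : ℝ≥0∞) {x y : Sph d} (h : ⟪x, y⟫ = 0) :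
    kernel α x y = 1 := by
  rw [kernel, Lambda_of_inner_eq_zero h]
  simp [h]

lemma kernel_of_abs_inner_eq_one {α : ℝ≥0∞} (hα : 0 < α) {x y : Sph d} (h : |⟪x, y⟫| = 1) :
    kernel α x y = 0 := by
  rw [kernel, Lambda_of_abs_inner_eq_one h]
  split_ifs with h1 h2
  · rw [h2] at h; simp at h
  · rfl
  · exact Real.zero_rpow (ENNReal.toReal_pos hα.ne' h1).ne'

lemma kernel_of_orthoParallel {α : ℝ≥0∞} (hα : 0 < α) {x y : Sph d} (h : OrthoParallel x y) :
    kernel α x y = 1 - ⟪x, y⟫ ^ 2 := by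
  rcases h with h | h
  · rw [kernel_of_inner_eq_zero α h, h]; simp
  · rw [kernel_of_abs_inner_eq_one hα h, ← sq_abs, h]; simp

lemma kernel_antitone {α β : ℝ≥0∞} (hα : 0 < α) (h : α ≤ β) (x y : Sph d) :
    kernel β x y ≤ kernel α x y := by
  rcases eq_or_lt_of_le (Lambda_nonneg x y) with h0 | h0
  -- Antitonicity of powers in the exponent needs a positive base, so `Λ = 0` is treated apart,
  -- through the common value of all kernels on parallel pairs.
  · have := orthoParallel_of_Lambda (x := x) (y := y) (Or.inl h0.symm)
    rw [kernel_of_orthoParallel hα this, kernel_of_orthoParallel (hα.trans_le h) this]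
  by_cases hβ : β = ∞
  · by_cases hc : ⟪x, y⟫ = 0
    · rw [kernel_of_inner_eq_zero _ hc, kernel_of_inner_eq_zero _ hc]
    · simpa [kernel, hβ, hc] using kernel_nonneg α x y
  · have hα' : α ≠ ∞ := ne_top_of_le_ne_top hβ h
    rw [kernel_of_ne_top hβ, kernel_of_ne_top hα']
    exact Real.rpow_le_rpow_of_exponent_ge h0 (Lambda_le_one x y) (ENNReal.toReal_mono hβ h)

lemma orthoParallel_of_kernel_eq {α β : ℝ≥0∞} (h : α < β) {x y : Sph d}
    (he : kernel β x y = kernel α x y) : OrthoParallel x y := by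
  by_contra hc
  have h0 : 0 < Lambda x y :=
    lt_of_le_of_ne (Lambda_nonneg x y) fun hh => hc (orthoParallel_of_Lambda (Or.inl hh.symm))
  have h1 : Lambda x y < 1 :=
    lt_of_le_of_ne (Lambda_le_one x y) fun hh => hc (orthoParallel_of_Lambda (Or.inr hh))
  have hα : α ≠ ∞ := h.ne_top
  by_cases hβ : β = ∞
  · have hc' : ⟪x, y⟫ ≠ 0 := fun hh => hc (Or.inl hh)
    have : kernel β x y = 0 := by simp [kernel, hβ, hc']
    rw [this, kernel_of_ne_top hα] at he
    exact (Real.rpow_pos_of_pos h0 _).ne he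
  · rw [kernel_of_ne_top hβ, kernel_of_ne_top hα] at he
    exact (Real.rpow_lt_rpow_of_exponent_gt h0 h1 ((ENNReal.toReal_lt_toReal hα hβ).2 h)).ne he

/-- With `c` the cosine, `1 - c² ≤ 2 - 2c`, the difference being `(1 - c)²`. -/
lemma Lambda_le_norm_sub (x y : Sph d) : Lambda x y ≤ ‖(x : Ambient d) - y‖ := by
  refine (Lambda_le_sqrt x y).trans ?_
  rw [Real.sqrt_le_left (norm_nonneg _), norm_sub_sq_real, norm_eq_of_mem_sphere,
    norm_eq_of_mem_sphere]
  nlinarith [sq_nonneg (1 - ⟪x, y⟫)]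

/-! ### Frames and measures carried by their axes. -/

/-- The orthonormal bases of the ambient space. -/
abbrev Frame (d : ℕ) : Type := OrthonormalBasis (Fin (d + 1)) ℝ (Ambient d)

/-- The vectors of an orthonormal basis as points of the sphere. -/
def Frame.pt (b : Frame d) (i : Fin (d + 1)) : Sph d := ⟨b i, by simp⟩

/-- The pair of antipodal points spanned by a basis vector. -/
def Frame.axis (b : Frame d) (i : Fin (d + 1)) : Set (Sph d) := {b.pt i, -b.pt i}

/-- A measure which gives the same mass to each axis of an orthonormal basis. -/
def EquiOn (b : Frame d) (μ : ProbabilityMeasure (Sph d)) : Prop :=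
  ∀ i, (μ : Measure (Sph d)).real (b.axis i) = 1 / ((d : ℝ) + 1)

@[simp] lemma Frame.coe_pt (b : Frame d) (i : Fin (d + 1)) : (b.pt i : Ambient d) = b i := rfl

lemma Frame.inner_pt (b : Frame d) (i j : Fin (d + 1)) :
    ⟪b.pt i, b.pt j⟫ = if i = j then 1 else 0 := by
  simpa using b.inner_eq_ite i j

lemma Frame.axis_finite (b : Frame d) (i : Fin (d + 1)) : (b.axis i).Finite := by
  simp [Frame.axis]

lemma Frame.measurableSet_axis (b : Frame d) (i : Fin (d + 1)) : MeasurableSet (b.axis i) :=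
  (b.axis_finite i).measurableSet

lemma Frame.axis_disjoint (b : Frame d) : Pairwise (Function.onFun Disjoint b.axis) := by
  intro i j hij
  have h := b.inner_pt i j
  have h1 := b.inner_pt j j
  rw [if_neg hij] at h
  rw [if_pos rfl] at h1
  refine Set.disjoint_left.2 fun x hx hx' => ?_
  rcases hx with rfl | rfl <;> rcases hx' with hx' | hx'
  · rw [hx', h1] at h; exact one_ne_zero h
  · rw [hx'] at h; simp at h
  · rw [neg_eq_iff_eq_neg.1 hx'] at h; simp at h
  · rw [neg_inj.1 hx', h1] at h; exact one_ne_zero h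

lemma real_iUnion_axis (b : Frame d) (μ : ProbabilityMeasure (Sph d)) :
    (μ : Measure (Sph d)).real (⋃ i, b.axis i)
      = ∑ i, (μ : Measure (Sph d)).real (b.axis i) :=
  measureReal_iUnion_fintype b.axis_disjoint b.measurableSet_axis

/-- The `d + 1` axes are disjoint and the total mass is at most `1`, so none of the lower bounds can
be strict. -/
lemma equiOn_of_le {b : Frame d} {μ : ProbabilityMeasure (Sph d)}
    (h : ∀ i, 1 / ((d : ℝ) + 1) ≤ (μ : Measure (Sph d)).real (b.axis i)) : EquiOn b μ := by
  have h1 : ∑ i, (μ : Measure (Sph d)).real (b.axis i) ≤ ∑ i : Fin (d + 1), 1 / ((d : ℝ) + 1) := by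
    rw [← real_iUnion_axis]
    refine measureReal_le_one.trans ?_
    simp
    field_simp
    exact le_rfl
  have h2 := (Finset.sum_eq_sum_iff_of_le fun i (_ : i ∈ Finset.univ) => h i).1
    (le_antisymm (Finset.sum_le_sum fun i _ => h i) h1)
  exact fun i => (h2 i (Finset.mem_univ i)).symm

lemma EquiOn.ae_mem {b : Frame d} {μ : ProbabilityMeasure (Sph d)} (h : EquiOn b μ) :
    ∀ᵐ x ∂(μ : Measure (Sph d)), x ∈ ⋃ i, b.axis i := by
  have h1 : (μ : Measure (Sph d)).real (⋃ i, b.axis i) = 1 := by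
    rw [real_iUnion_axis, Finset.sum_congr rfl fun i _ => h i]
    simp
    field_simp
  refine (mem_ae_iff_prob_eq_one (MeasurableSet.iUnion b.measurableSet_axis)).2 ?_
  rw [Measure.real, ENNReal.toReal_eq_one_iff] at h1
  exact h1

lemma integral_even_of_ae_mem {b : Frame d} {μ : ProbabilityMeasure (Sph d)}
    (h : ∀ᵐ x ∂(μ : Measure (Sph d)), x ∈ ⋃ i, b.axis i) {f : Sph d → ℝ}
    (hf : ∀ x, f (-x) = f x) :
    ∫ x, f x ∂(μ : Measure (Sph d))
      = ∑ i, (μ : Measure (Sph d)).real (b.axis i) * f (b.pt i) := by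
  have h1 : ∫ x, f x ∂(μ : Measure (Sph d))
      = ∫ x in ⋃ i, b.axis i, f x ∂(μ : Measure (Sph d)) := by
    rw [Measure.restrict_eq_self_of_ae_mem h]
  rw [h1, integral_iUnion_fintype b.measurableSet_axis b.axis_disjoint
    fun i => IntegrableOn.of_finite (b.axis_finite i)]
  refine Finset.sum_congr rfl fun i _ => ?_
  have h2 : EqOn f (fun _ => f (b.pt i)) (b.axis i) := by
    rintro x (rfl | rfl)
    · rfl
    · exact hf _
  rw [setIntegral_congr_fun (b.measurableSet_axis i) h2, setIntegral_const, smul_eq_mul]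

lemma EquiOn.integral_even {b : Frame d} {μ : ProbabilityMeasure (Sph d)} (h : EquiOn b μ)
    {f : Sph d → ℝ} (hf : ∀ x, f (-x) = f x) :
    ∫ x, f x ∂(μ : Measure (Sph d)) = 1 / ((d : ℝ) + 1) * ∑ i, f (b.pt i) := by
  rw [integral_even_of_ae_mem h.ae_mem hf, Finset.mul_sum]
  exact Finset.sum_congr rfl fun i _ => by rw [h i]

lemma EquiOn.real_symm {b : Frame d} {μ : ProbabilityMeasure (Sph d)} (h : EquiOn b μ)
    {B : Set (Sph d)} (hB : MeasurableSet B) (hs : ∀ x, -x ∈ B ↔ x ∈ B) :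
    (μ : Measure (Sph d)).real B
      = 1 / ((d : ℝ) + 1) * ∑ i, B.indicator (fun _ => (1 : ℝ)) (b.pt i) := by
  rw [← h.integral_even, integral_indicator_const _ hB]
  · simp
  · intro x
    by_cases hx : x ∈ B
    · rw [indicator_of_mem hx, indicator_of_mem ((hs x).2 hx)]
    · rw [indicator_of_notMem hx, indicator_of_notMem (mt (hs x).1 hx)]

/-! ### Rotations and essential equivalence. -/

lemma mem_symm (A : Set (Sph d)) (x : Sph d) : -x ∈ A ∪ -A ↔ x ∈ A ∪ -A := by
  simp [or_comm]

lemma mem_rotate (M : Ambient d ≃ₗᵢ[ℝ] Ambient d) (A : Set (Sph d)) (y : Sph d) :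
    y ∈ rotate M A ↔ (⟨M.symm y, by simp⟩ : Sph d) ∈ A := by
  constructor
  · rintro ⟨x, hx, h⟩
    convert hx
    simp [h]
  · intro h
    exact ⟨_, h, by simp⟩

lemma isOpen_rotate (M : Ambient d ≃ₗᵢ[ℝ] Ambient d) {A : Set (Sph d)} (hA : IsOpen A) :
    IsOpen (rotate M A) := by
  have : rotate M A = (fun y : Sph d => (⟨M.symm y, by simp⟩ : Sph d)) ⁻¹' A := by
    ext y; exact mem_rotate M A y
  rw [this]
  exact hA.preimage (by fun_prop)

lemma det_eq_one_or_neg_one (M : Ambient d ≃ₗᵢ[ℝ] Ambient d) :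
    LinearMap.det (M.toLinearEquiv : Ambient d →ₗ[ℝ] Ambient d) = 1 ∨
    LinearMap.det (M.toLinearEquiv : Ambient d →ₗ[ℝ] Ambient d) = -1 := by
  let b : Frame d := EuclideanSpace.basisFun _ _
  have h := b.toBasis.det_comp (M.toLinearEquiv : Ambient d →ₗ[ℝ] Ambient d) b.toBasis
  rw [Module.Basis.det_self, mul_one] at h
  rw [← h]
  have := b.det_to_matrix_orthonormalBasis_real (b.map M)
  convert this using 3 <;> ext <;> simp

/-- If the isometry taking `b` to `c` reverses orientation, precompose it with the reflection that
flips `b 0`. The sign it introduces is invisible on axes. -/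
lemma exists_rotation (b c : Frame d) : ∃ M : Ambient d ≃ₗᵢ[ℝ] Ambient d,
    LinearMap.det (M.toLinearEquiv : Ambient d →ₗ[ℝ] Ambient d) = 1 ∧
    ∀ i, M (b i) = c i ∨ M (b i) = -c i := by
  let M := b.equiv c (Equiv.refl _)
  have hM : ∀ i, M (b i) = c i := fun i => by simp [M]
  rcases det_eq_one_or_neg_one M with h | h
  · exact ⟨M, h, fun i => Or.inl (hM i)⟩
  let R := (ℝ ∙ b 0)ᗮ.reflection
  have hR : LinearMap.det (R.toLinearEquiv : Ambient d →ₗ[ℝ] Ambient d) = -1 := by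
    have := (ℝ ∙ b 0)ᗮ.det_reflection
    rw [Submodule.orthogonal_orthogonal, finrank_span_singleton (b.orthonormal.ne_zero 0),
      pow_one] at this
    exact this
  refine ⟨R.trans M, ?_, fun i => ?_⟩
  · have : ((R.trans M).toLinearEquiv : Ambient d →ₗ[ℝ] Ambient d)
        = (M.toLinearEquiv : Ambient d →ₗ[ℝ] Ambient d) ∘ₗ
          (R.toLinearEquiv : Ambient d →ₗ[ℝ] Ambient d) := rfl
    rw [this, LinearMap.det_comp, h, hR]
    norm_num
  · by_cases hi : i = 0
    · right
      subst hi
      rw [LinearIsometryEquiv.trans_apply, Submodule.reflection_orthogonalComplement_singleton_eq_neg,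
        map_neg, hM]
    · left
      rw [LinearIsometryEquiv.trans_apply, Submodule.reflection_mem_subspace_eq_self, hM]
      rw [Submodule.mem_orthogonal_singleton_iff_inner_right]
      exact b.orthonormal.2 (Ne.symm hi)

lemma EquiOn.essEquiv {b c : Frame d} {μ ν : ProbabilityMeasure (Sph d)} (hμ : EquiOn b μ)
    (hν : EquiOn c ν) : EssEquiv μ ν := by
  obtain ⟨M, hdet, hM⟩ := exists_rotation b c
  refine ⟨M, hdet, fun A hA => ?_⟩
  have ho : IsOpen (A ∪ -A) := hA.union hA.neg
  have hs : ∀ x, -x ∈ rotate M (A ∪ -A) ↔ x ∈ rotate M (A ∪ -A) := fun x => by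
    rw [mem_rotate, mem_rotate, ← mem_symm]
    convert Iff.rfl using 2
    ext1
    simp
  rw [← measureReal_eq_measureReal_iff, hμ.real_symm ho.measurableSet (mem_symm A),
    hν.real_symm (isOpen_rotate M ho).measurableSet hs]
  congr 1
  refine Finset.sum_congr rfl fun i _ => ?_
  have : b.pt i ∈ A ∪ -A ↔ c.pt i ∈ rotate M (A ∪ -A) := by
    have h1 : (b.pt i ∈ A ∪ -A) ↔
        (⟨M (b i), by simp⟩ : Sph d) ∈ rotate M (A ∪ -A) := by
      rw [mem_rotate]
      convert Iff.rfl using 2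
      ext1
      simp
    rw [h1]
    rcases hM i with h | h
    · convert Iff.rfl using 2
      ext1
      simp [h]
    · rw [← hs]
      convert Iff.rfl using 2
      ext1
      simp [h]
  by_cases h : b.pt i ∈ A ∪ -A
  · rw [indicator_of_mem h, indicator_of_mem (this.1 h)]
  · rw [indicator_of_notMem h, indicator_of_notMem (mt this.2 h)]

/-! ### The uniform measure of a frame; description of `simplexEqMeasures`. -/

/-- The measure which equidistributes its mass over an orthonormal basis. -/
def Frame.measure (b : Frame d) : Measure (Sph d) :=
  ∑ i, ((d : ℝ≥0∞) + 1)⁻¹ • Measure.dirac (b.pt i)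

lemma Frame.measure_apply (b : Frame d) {A : Set (Sph d)} (hA : MeasurableSet A) :
    b.measure A = ∑ i, ((d : ℝ≥0∞) + 1)⁻¹ * A.indicator 1 (b.pt i) := by
  simp [Frame.measure, Measure.finsetSum_apply, hA]

instance (b : Frame d) : IsProbabilityMeasure b.measure := by
  constructor
  rw [b.measure_apply MeasurableSet.univ]
  simp
  exact ENNReal.mul_inv_cancel (by simp) (by simp)

lemma Frame.le_measure (b : Frame d) {i : Fin (d + 1)} {A : Set (Sph d)} (hA : MeasurableSet A)
    (hi : b.pt i ∈ A) : ((d : ℝ≥0∞) + 1)⁻¹ ≤ b.measure A := by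
  rw [b.measure_apply hA]
  refine le_trans ?_ (Finset.single_le_sum (fun j _ => zero_le) (Finset.mem_univ i))
  simp [hi]

/-- The measure which equidistributes its mass over an orthonormal basis, as a probability
measure. -/
def Frame.prob (b : Frame d) : ProbabilityMeasure (Sph d) := ⟨b.measure, inferInstance⟩

lemma Frame.le_prob_real (b : Frame d) {i : Fin (d + 1)} {A : Set (Sph d)} (hA : MeasurableSet A)
    (hi : b.pt i ∈ A) : 1 / ((d : ℝ) + 1) ≤ (b.prob : Measure (Sph d)).real A := by
  have h := ENNReal.toReal_mono (measure_ne_top _ _) (b.le_measure hA hi)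
  have h1 : (((d : ℝ≥0∞) + 1)⁻¹).toReal = 1 / ((d : ℝ) + 1) := by
    rw [ENNReal.toReal_inv, ENNReal.toReal_add (by simp) (by simp)]
    simp
  rw [h1] at h
  exact h

lemma Frame.equiOn_prob (b : Frame d) : EquiOn b b.prob :=
  equiOn_of_le fun i => b.le_prob_real (b.measurableSet_axis i) (Or.inl rfl)

lemma Frame.support_prob (b : Frame d) : (b.prob : Measure (Sph d)).support = range b.pt := by
  refine Subset.antisymm ?_ ?_
  · refine Measure.support_subset_of_isClosed (finite_range _).isClosed ?_
    rw [mem_ae_iff]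
    change b.measure _ = 0
    rw [b.measure_apply (finite_range _).measurableSet.compl]
    simp
  · rintro _ ⟨i, rfl⟩
    rw [Measure.support_eq_forall_isOpen]
    intro U hU hU'
    refine lt_of_lt_of_le ?_ (b.le_measure hU'.measurableSet hU)
    simp [ENNReal.inv_pos, ENNReal.add_eq_top]

lemma Frame.prob_mem (b : Frame d) : b.prob ∈ onEqMeasures d := by
  refine ⟨⟨b, ?_⟩, ?_⟩
  · rw [b.support_prob, ← range_comp]
    rfl
  · rw [b.support_prob]
    rintro _ ⟨i, rfl⟩
    refine le_antisymm ?_ (b.le_prob_real (measurableSet_singleton _) rfl)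
    rw [← b.equiOn_prob i]
    exact measureReal_mono (by simp [Frame.axis])

/-- Removes the rotation and the auxiliary measure from the definition; all later arguments use only
the masses of the axes. -/
lemma mem_simplexEqMeasures_iff (μ : ProbabilityMeasure (Sph d)) :
    μ ∈ simplexEqMeasures d ↔ ∃ b : Frame d, EquiOn b μ := by
  constructor
  · rintro ⟨ν, ⟨⟨(c : Frame d), hc⟩, hm⟩, M, -, hM⟩
    have hν : EquiOn c ν := by
      refine equiOn_of_le fun i => ?_
      obtain ⟨x, hx, hxi⟩ : (c i : Ambient d) ∈
          (fun x : Sph d => (x : Ambient d)) '' (ν : Measure (Sph d)).support := by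
        rw [hc]; exact mem_range_self i
      have : x = c.pt i := Subtype.ext hxi
      rw [← hm x hx, this]
      exact measureReal_mono (by simp [Frame.axis])
    refine ⟨c.map M.symm, fun i => ?_⟩
    set b : Frame d := c.map M.symm
    have hb : ∀ i, M (b i) = c i := fun i => by simp [b]
    -- Essential equivalence tests only open sets, while an axis is closed; its complement is open
    -- and symmetric, and carries the same information.
    have hsymm : (b.axis i)ᶜ ∪ -(b.axis i)ᶜ = (b.axis i)ᶜ := by
      have : -(b.axis i)ᶜ = (b.axis i)ᶜ := by
        ext x
        simp [Frame.axis, or_comm]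
      rw [this, union_self]
    have hrot : rotate M (b.axis i)ᶜ = (c.axis i)ᶜ := by
      ext y
      rw [mem_rotate, mem_compl_iff, mem_compl_iff, not_iff_not]
      simp only [Frame.axis, mem_insert_iff, mem_singleton_iff, Subtype.ext_iff]
      have h1 : M.symm (y : Ambient d) = b i ↔ (y : Ambient d) = c i := by
        rw [← hb, LinearIsometryEquiv.symm_apply_eq]
      have h2 : M.symm (y : Ambient d) = -b i ↔ (y : Ambient d) = -c i := by
        rw [← hb, LinearIsometryEquiv.symm_apply_eq, map_neg]
      simpa using or_congr h1 h2
    have h := hM (b.axis i)ᶜ (b.axis_finite i).isClosed.isOpen_compl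
    rw [hsymm, hrot] at h
    have h' : (μ : Measure (Sph d)).real (b.axis i)ᶜ = (ν : Measure (Sph d)).real (c.axis i)ᶜ := by
      rw [Measure.real, h, Measure.real]
    rw [probReal_compl_eq_one_sub (b.measurableSet_axis i),
      probReal_compl_eq_one_sub (c.measurableSet_axis i), hν i] at h'
    linarith
  · rintro ⟨b, hb⟩
    exact ⟨b.prob, b.prob_mem, hb.essEquiv b.equiOn_prob⟩

/-! ### Energy of frame measures and the second-moment bound. -/

/-- The product of a probability measure on the sphere with itself. -/
abbrev selfProd (μ : ProbabilityMeasure (Sph d)) : Measure (Sph d × Sph d) :=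
  (μ : Measure (Sph d)).prod μ

lemma integrable_of_continuous {X : Type*} [TopologicalSpace X] [CompactSpace X]
    [MeasurableSpace X] [OpensMeasurableSpace X] {μ : Measure X} [IsFiniteMeasure μ] {f : X → ℝ}
    (hf : Continuous f) : Integrable f μ :=
  hf.integrable_of_hasCompactSupport (HasCompactSupport.of_compactSpace f)

lemma kernel_integrable_prod (α : ℝ≥0∞) (μ ν : Measure (Sph d)) [IsFiniteMeasure μ]
    [IsFiniteMeasure ν] : Integrable (fun p : Sph d × Sph d => kernel α p.1 p.2) (μ.prod ν) := by
  refine Integrable.of_bound (kernel_measurable α).aestronglyMeasurable 1 (ae_of_all _ fun p => ?_)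
  rw [Real.norm_of_nonneg (kernel_nonneg _ _ _)]
  exact kernel_le_one _ _ _

lemma kernel_integrable_selfProd (α : ℝ≥0∞) (μ : ProbabilityMeasure (Sph d)) :
    Integrable (fun p : Sph d × Sph d => kernel α p.1 p.2) (selfProd μ) :=
  kernel_integrable_prod α _ _

lemma kernel_integrable (α : ℝ≥0∞) (x : Sph d) (μ : Measure (Sph d)) [IsFiniteMeasure μ] :
    Integrable (fun y => kernel α x y) μ := by
  refine Integrable.of_bound
    ((kernel_measurable α).comp measurable_prodMk_left).aestronglyMeasurable 1
    (ae_of_all _ fun p => ?_)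
  rw [Real.norm_of_nonneg (kernel_nonneg _ _ _)]
  exact kernel_le_one _ _ _

lemma energy_eq_prod (α : ℝ≥0∞) (μ : ProbabilityMeasure (Sph d)) :
    energy α μ = 1 / 2 * ∫ p, kernel α p.1 p.2 ∂(selfProd μ) := by
  rw [energy, integral_prod_symm _ (kernel_integrable_prod α _ _)]

lemma EquiOn.potential {b : Frame d} {μ : ProbabilityMeasure (Sph d)} (h : EquiOn b μ)
    (α : ℝ≥0∞) (x : Sph d) :
    ∫ y, kernel α x y ∂(μ : Measure (Sph d))
      = 1 / ((d : ℝ) + 1) * ∑ i, kernel α x (b.pt i) :=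
  h.integral_even fun y => by rw [kernel_comm, kernel_neg, kernel_comm]

lemma Frame.sum_kernel {b : Frame d} {α : ℝ≥0∞} (hα : 0 < α) (j : Fin (d + 1)) :
    ∑ i, kernel α (b.pt i) (b.pt j) = d := by
  have h : ∀ i, kernel α (b.pt i) (b.pt j) = 1 - if i = j then 1 else 0 := by
    intro i
    have h1 := b.inner_pt i j
    split_ifs at h1 ⊢ with hij
    · rw [kernel_of_abs_inner_eq_one hα (by rw [h1, abs_one])]; simp
    · rw [kernel_of_inner_eq_zero _ h1]; simp
  rw [Finset.sum_congr rfl fun i _ => h i]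
  simp

/-- Twice the energy of the measures equidistributed over an orthonormal basis. -/
def simplexValue (d : ℕ) : ℝ := d / ((d : ℝ) + 1)

lemma simplexValue_eq (d : ℕ) : simplexValue d = 1 - 1 / ((d : ℝ) + 1) := by
  rw [simplexValue]; field_simp; ring

lemma EquiOn.energy_eq {b : Frame d} {μ : ProbabilityMeasure (Sph d)} (h : EquiOn b μ)
    {α : ℝ≥0∞} (hα : 0 < α) : energy α μ = 1 / 2 * simplexValue d := by
  rw [energy, h.integral_even]
  · have h1 : ∀ i, ∫ x, kernel α x (b.pt i) ∂(μ : Measure (Sph d)) = 1 / ((d : ℝ) + 1) * d := by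
      intro i
      rw [h.integral_even fun x => kernel_neg α x _, Frame.sum_kernel hα]
    simp_rw [h1]
    simp [simplexValue]
    field_simp
  · intro x
    congr 1
    ext y
    rw [kernel_comm, kernel_neg, kernel_comm]

lemma inner_eq_sum (x y : Sph d) :
    ⟪x, y⟫ = ∑ j, (x : Ambient d) j * (y : Ambient d) j := by
  simp [PiLp.inner_apply, mul_comm]

lemma sum_coord_sq (x : Sph d) : ∑ j, (x : Ambient d) j ^ 2 = 1 := by
  have := EuclideanSpace.real_norm_sq_eq (x : Ambient d)
  rw [norm_eq_of_mem_sphere] at this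
  simpa using this.symm

/-- Expanding in coordinates gives the sum of squares of the entries of `∫ x xᵀ dμ`. Discard the
off-diagonal entries and apply Cauchy–Schwarz to the `d + 1` diagonal ones, which sum to `1`. -/
lemma le_integral_inner_sq (μ : ProbabilityMeasure (Sph d)) :
    1 / ((d : ℝ) + 1) ≤ ∫ p, ⟪p.1, p.2⟫ ^ 2 ∂(selfProd μ) := by
  have h1 : ∫ p, ⟪p.1, p.2⟫ ^ 2 ∂(selfProd μ) = ∑ j, ∑ k,
      (∫ x : Sph d, (x : Ambient d) j * (x : Ambient d) k ∂(μ : Measure (Sph d))) ^ 2 := by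
    have h2 : ∀ p : Sph d × Sph d, ⟪p.1, p.2⟫ ^ 2 = ∑ j, ∑ k,
        ((p.1 : Ambient d) j * (p.1 : Ambient d) k) *
          ((p.2 : Ambient d) j * (p.2 : Ambient d) k) := by
      intro p
      rw [inner_eq_sum, pow_two, Finset.sum_mul_sum]
      exact Finset.sum_congr rfl fun j _ => Finset.sum_congr rfl fun k _ => by ring
    simp_rw [h2]
    rw [integral_finsetSum _ fun j _ => integrable_of_continuous (by fun_prop)]
    refine Finset.sum_congr rfl fun j _ => ?_
    rw [integral_finsetSum _ fun j _ => integrable_of_continuous (by fun_prop)]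
    refine Finset.sum_congr rfl fun k _ => ?_
    rw [integral_prod_mul (fun x : Sph d => (x : Ambient d) j * (x : Ambient d) k)
      (fun x : Sph d => (x : Ambient d) j * (x : Ambient d) k), pow_two]
  rw [h1]
  set a : Fin (d + 1) → ℝ :=
    fun j => ∫ x : Sph d, (x : Ambient d) j * (x : Ambient d) j ∂(μ : Measure (Sph d))
  have ha : ∑ j, a j = 1 := by
    rw [← integral_finsetSum _ fun j _ => integrable_of_continuous (by fun_prop)]
    simp_rw [← pow_two, sum_coord_sq]
    simp
  have h3 : ∑ j, a j ^ 2 ≤ ∑ j, ∑ k,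
      (∫ x : Sph d, (x : Ambient d) j * (x : Ambient d) k ∂(μ : Measure (Sph d))) ^ 2 :=
    Finset.sum_le_sum fun j _ => Finset.single_le_sum
      (f := fun k => (∫ x : Sph d, (x : Ambient d) j * (x : Ambient d) k
        ∂(μ : Measure (Sph d))) ^ 2) (fun k _ => sq_nonneg _) (Finset.mem_univ j)
  have h4 := sq_sum_le_card_mul_sum_sq (s := Finset.univ) (f := a)
  rw [ha] at h4
  simp at h4
  refine le_trans ?_ h3
  rw [div_le_iff₀ (by positivity)]
  linarith

lemma integrable_inner_sq (μ : ProbabilityMeasure (Sph d)) :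
    Integrable (fun p : Sph d × Sph d => ⟪p.1, p.2⟫ ^ 2) (selfProd μ) :=
  integrable_of_continuous (by fun_prop)

lemma integral_one_sub_inner_sq (μ : ProbabilityMeasure (Sph d)) :
    ∫ p, (1 - ⟪p.1, p.2⟫ ^ 2) ∂(selfProd μ) = 1 - ∫ p, ⟪p.1, p.2⟫ ^ 2 ∂(selfProd μ) := by
  rw [integral_sub (integrable_const _) (integrable_inner_sq μ)]
  simp

/-! ### Measures whose points are pairwise orthogonal or parallel. -/

lemma isClosed_orthoParallel : IsClosed {p : Sph d × Sph d | OrthoParallel p.1 p.2} :=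
  (isClosed_eq (f := fun p : Sph d × Sph d => ⟪p.1, p.2⟫) (by fun_prop) continuous_const).union
    (isClosed_eq (f := fun p : Sph d × Sph d => |⟪p.1, p.2⟫|) (by fun_prop) continuous_const)

lemma orthoParallel_of_mem_support {μ : ProbabilityMeasure (Sph d)}
    (h : ∀ᵐ p ∂(selfProd μ), OrthoParallel p.1 p.2) {x y : Sph d}
    (hx : x ∈ (μ : Measure (Sph d)).support) (hy : y ∈ (μ : Measure (Sph d)).support) :
    OrthoParallel x y := by
  by_contra hc
  have h1 : {p : Sph d × Sph d | OrthoParallel p.1 p.2}ᶜ ∈ 𝓝 (x, y) :=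
    isClosed_orthoParallel.isOpen_compl.mem_nhds hc
  obtain ⟨U, hU, V, hV, hUV⟩ := mem_nhds_prod_iff.1 h1
  have h2 : selfProd μ (U ×ˢ V) = 0 := measure_mono_null hUV h
  rw [Measure.prod_prod, mul_eq_zero] at h2
  rw [Measure.mem_support_iff_forall] at hx hy
  rcases h2 with h2 | h2
  · exact (hx U hU).ne' h2
  · exact (hy V hV).ne' h2

lemma eq_or_eq_neg_of_abs_inner_eq_one {x y : Ambient d} (hx : ‖x‖ = 1) (hy : ‖y‖ = 1)
    (h : |inner ℝ x y| = 1) : x = y ∨ x = -y := by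
  rcases eq_or_eq_neg_of_abs_eq h with h | h
  · exact Or.inl ((inner_eq_one_iff_of_norm_eq_one hx hy).1 h)
  · right
    refine (inner_eq_one_iff_of_norm_eq_one (𝕜 := ℝ) hx (by rwa [norm_neg])).1 ?_
    rw [inner_neg_right, h, neg_neg]

lemma orthonormal_insert_of_forall_inner_eq_zero {v : Set (Ambient d)}
    (hv : Orthonormal ℝ (Subtype.val : v → Ambient d)) {x : Ambient d} (hx : ‖x‖ = 1)
    (h : ∀ u ∈ v, inner ℝ x u = 0) :
    Orthonormal ℝ (Subtype.val : ↥(insert x v) → Ambient d) := by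
  refine ⟨?_, ?_⟩
  · rintro ⟨u, rfl | hu⟩
    · exact hx
    · exact hv.1 ⟨u, hu⟩
  · rintro ⟨u, rfl | hu⟩ ⟨w, hw⟩ hne
    · rcases hw with rfl | hw
      · exact absurd rfl hne
      · exact h w hw
    · rcases hw with rfl | hw
      · change inner ℝ u w = 0
        rw [real_inner_comm]; exact h u hu
      · exact hv.2 (i := ⟨u, hu⟩) (j := ⟨w, hw⟩) fun hh => hne (Subtype.ext (congrArg (·.1) hh))

/-- Extend a maximal orthonormal subset `v` of `T` to a basis. A point of `T` orthogonal to all of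
`v` would contradict maximality; any other is parallel to a member of `v`. -/
lemma exists_frame_of_orthoParallel {T : Set (Sph d)}
    (h : ∀ x ∈ T, ∀ y ∈ T, OrthoParallel x y) : ∃ b : Frame d, T ⊆ ⋃ i, b.axis i := by
  let S : Set (Set (Ambient d)) :=
    {v | v ⊆ Subtype.val '' T ∧ Orthonormal ℝ (Subtype.val : v → Ambient d)}
  obtain ⟨v, hv⟩ := zorn_subset S fun c hcS hc => by
    refine ⟨⋃₀ c, ⟨sUnion_subset fun s hs => (hcS hs).1, ?_⟩, fun s hs => subset_sUnion_of_mem hs⟩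
    exact orthonormal_sUnion_of_directed hc.directedOn fun s hs => (hcS hs).2
  obtain ⟨u, b, hvu, hb⟩ := hv.prop.2.exists_orthonormalBasis_extension
  have hcard : Fintype.card u = d + 1 := by
    rw [← Module.finrank_eq_card_basis b.toBasis]; simp
  let e : u ≃ Fin (d + 1) := Fintype.equivFinOfCardEq hcard
  let b' : Frame d := b.reindex e
  have hmem : ∀ w ∈ v, ∃ i, b' i = w := fun w hw =>
    ⟨e ⟨w, hvu hw⟩, by simp [b', hb]⟩
  refine ⟨b', fun x hx => ?_⟩
  by_cases hall : ∀ w ∈ v, inner ℝ (x : Ambient d) w = 0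
  · have h1 : insert (x : Ambient d) v ∈ S :=
      ⟨insert_subset ⟨x, hx, rfl⟩ hv.prop.1,
        orthonormal_insert_of_forall_inner_eq_zero hv.prop.2 (norm_eq_of_mem_sphere x) hall⟩
    have h2 : (x : Ambient d) ∈ v := hv.le_of_ge h1 (subset_insert _ _) (mem_insert _ _)
    have h3 := hall _ h2
    rw [real_inner_self_eq_norm_sq, norm_eq_of_mem_sphere] at h3
    norm_num at h3
  · push Not at hall
    obtain ⟨w, hw, hne⟩ := hall
    obtain ⟨y, hy, rfl⟩ := hv.prop.1 hw
    obtain ⟨i, hi⟩ := hmem _ hw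
    have h1 : |⟪x, y⟫| = 1 := (h x hx y hy).resolve_left hne
    refine mem_iUnion.2 ⟨i, ?_⟩
    rcases eq_or_eq_neg_of_abs_inner_eq_one (norm_eq_of_mem_sphere x) (norm_eq_of_mem_sphere y) h1
      with h2 | h2
    · left; ext1; rw [h2, ← hi]; rfl
    · right; rw [mem_singleton_iff]; ext1; rw [h2, ← hi]; rfl

/-- A measure whose points are almost surely orthogonal or parallel, and whose energy is at least
that of an orthonormal basis, is equidistributed over the axes of an orthonormal basis. -/
lemma exists_equiOn {μ : ProbabilityMeasure (Sph d)} (h : ∀ᵐ p ∂(selfProd μ), OrthoParallel p.1 p.2)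
    {α : ℝ≥0∞} (hα : 0 < α) (hE : 1 / 2 * simplexValue d ≤ energy α μ) :
    ∃ b : Frame d, EquiOn b μ := by
  obtain ⟨b, hb⟩ := exists_frame_of_orthoParallel fun x hx y hy =>
    orthoParallel_of_mem_support h hx hy
  have hmem : ∀ᵐ x ∂(μ : Measure (Sph d)), x ∈ ⋃ i, b.axis i :=
    mem_of_superset Measure.support_mem_ae hb
  set m : Fin (d + 1) → ℝ := fun i => (μ : Measure (Sph d)).real (b.axis i)
  have hsum : ∑ i, m i = 1 := by
    have := integral_even_of_ae_mem hmem (f := fun _ => 1) fun _ => rfl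
    simp only [integral_const, probReal_univ, smul_eq_mul, mul_one] at this
    exact this.symm
  have hin : ∫ p, ⟪p.1, p.2⟫ ^ 2 ∂(selfProd μ) = ∑ i, m i ^ 2 := by
    rw [integral_prod _ (integrable_inner_sq μ), integral_even_of_ae_mem hmem]
    · refine Finset.sum_congr rfl fun i _ => ?_
      rw [integral_even_of_ae_mem hmem fun x => by simp]
      simp_rw [b.inner_pt]
      simp [m, pow_two]
    · intro x; simp
  -- On such pairs the kernel equals `1 - ⟪x, y⟫²`, so twice the energy is `1 - ∑ m i ^ 2`.
  have hsq : ∑ i, m i ^ 2 ≤ 1 / ((d : ℝ) + 1) := by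
    rw [energy_eq_prod, integral_congr_ae (h.mono fun p hp => kernel_of_orthoParallel hα hp),
      integral_one_sub_inner_sq, hin, simplexValue_eq] at hE
    linarith
  -- The variance of the masses about their mean `1 / (d + 1)`.
  have h0 : ∑ i, (m i - 1 / ((d : ℝ) + 1)) ^ 2 ≤ 0 := by
    have h1 : ∀ i, (m i - 1 / ((d : ℝ) + 1)) ^ 2
        = m i ^ 2 - 2 / ((d : ℝ) + 1) * m i + (1 / ((d : ℝ) + 1)) ^ 2 := fun i => by ring
    simp_rw [h1]
    rw [Finset.sum_add_distrib, Finset.sum_sub_distrib, ← Finset.mul_sum, hsum]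
    simp only [Finset.sum_const, Finset.card_univ, Fintype.card_fin, nsmul_eq_mul]
    push_cast
    have : ((d : ℝ) + 1) * (1 / ((d : ℝ) + 1)) ^ 2 = 1 / ((d : ℝ) + 1) := by field_simp
    have h2 : 2 / ((d : ℝ) + 1) = 2 * (1 / ((d : ℝ) + 1)) := by ring
    rw [this, h2]
    linarith
  refine ⟨b, fun i => ?_⟩
  have h1 := (Finset.sum_eq_zero_iff_of_nonneg fun i _ => sq_nonneg (m i - 1 / ((d : ℝ) + 1))).1
    (le_antisymm h0 (Finset.sum_nonneg fun i _ => sq_nonneg _)) i (Finset.mem_univ i)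
  have h2 := (pow_eq_zero_iff two_ne_zero).1 h1
  exact sub_eq_zero.1 h2

/-! ### Monotonicity in the exponent and the equality cases. -/

/-- The energy is maximized by the measures equidistributed over an orthonormal basis. -/
def SimplexMaximizes (d : ℕ) (α : ℝ≥0∞) : Prop :=
  ∀ ν : ProbabilityMeasure (Sph d), energy α ν ≤ 1 / 2 * simplexValue d

/-- The standard basis of the ambient space. -/
def stdFrame (d : ℕ) : Frame d := EuclideanSpace.basisFun _ _

lemma simplexEqMeasures_nonempty (d : ℕ) : (simplexEqMeasures d).Nonempty :=
  ⟨(stdFrame d).prob, (mem_simplexEqMeasures_iff _).2 ⟨_, (stdFrame d).equiOn_prob⟩⟩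

lemma energy_of_mem {μ : ProbabilityMeasure (Sph d)} (h : μ ∈ simplexEqMeasures d) {α : ℝ≥0∞}
    (hα : 0 < α) : energy α μ = 1 / 2 * simplexValue d := by
  obtain ⟨b, hb⟩ := (mem_simplexEqMeasures_iff _).1 h
  exact hb.energy_eq hα

lemma energy_antitone {α β : ℝ≥0∞} (hα : 0 < α) (h : α ≤ β) (μ : ProbabilityMeasure (Sph d)) :
    energy β μ ≤ energy α μ := by
  rw [energy_eq_prod, energy_eq_prod]
  have := integral_mono (kernel_integrable_selfProd β μ) (kernel_integrable_selfProd α μ)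
    fun p => kernel_antitone hα h p.1 p.2
  linarith

lemma SimplexMaximizes.mono {α β : ℝ≥0∞} (hα : 0 < α) (h : α ≤ β) (hm : SimplexMaximizes d α) :
    SimplexMaximizes d β := fun ν => (energy_antitone hα h ν).trans (hm ν)

lemma ae_eq_of_integral_le {X : Type*} [MeasurableSpace X] {μ : Measure X} {f g : X → ℝ}
    (hf : Integrable f μ) (hg : Integrable g μ) (hfg : ∀ x, f x ≤ g x)
    (h : ∫ x, g x ∂μ ≤ ∫ x, f x ∂μ) : ∀ᵐ x ∂μ, f x = g x := by
  have h1 : ∫ x, (g - f) x ∂μ = 0 := by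
    have := integral_mono hf hg hfg
    rw [integral_sub' hg hf]
    linarith
  replace h1 := (integral_eq_zero_iff_of_nonneg (fun x => sub_nonneg.2 (hfg x)) (hg.sub hf)).1 h1
  filter_upwards [h1] with x hx
  exact (sub_eq_zero.1 hx).symm

/-- A maximizer at `β` satisfies `value ≤ E_β ≤ E_α ≤ value`, so the two kernels agree almost
everywhere, which happens only on orthogonal or parallel pairs. -/
lemma SimplexMaximizes.argmax_eq {α β : ℝ≥0∞} (hα : 0 < α) (h : α < β)
    (hm : SimplexMaximizes d α) : simplexEqMeasures d = argmaxEnergy d β := by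
  have hβ := hα.trans h
  have hmβ := hm.mono hα h.le
  refine Subset.antisymm (fun μ hμ ν => ?_) fun μ hμ => ?_
  · rw [energy_of_mem hμ hβ]
    exact hmβ ν
  · obtain ⟨ν, hν⟩ := simplexEqMeasures_nonempty d
    have h1 : 1 / 2 * simplexValue d ≤ energy β μ := energy_of_mem hν hβ ▸ hμ ν
    have h2 := hm μ
    refine (mem_simplexEqMeasures_iff _).2 (exists_equiOn ?_ hβ h1)
    have h3 : ∀ᵐ p ∂(selfProd μ), kernel β p.1 p.2 = kernel α p.1 p.2 := by
      refine ae_eq_of_integral_le (kernel_integrable_selfProd β μ) (kernel_integrable_selfProd α μ)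
        (fun p => kernel_antitone hα h.le p.1 p.2) ?_
      rw [energy_eq_prod] at h1 h2
      linarith
    exact h3.mono fun p hp => orthoParallel_of_kernel_eq h hp

lemma mem_of_le_energy_two {μ : ProbabilityMeasure (Sph d)}
    (h : 1 / 2 * simplexValue d ≤ energy 2 μ) : ∃ b : Frame d, EquiOn b μ := by
  refine exists_equiOn ?_ two_pos h
  have h3 : ∀ᵐ p ∂(selfProd μ), kernel 2 p.1 p.2 = 1 - ⟪p.1, p.2⟫ ^ 2 := by
    refine ae_eq_of_integral_le (kernel_integrable_selfProd 2 μ)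
      (integrable_of_continuous (by fun_prop))
      (fun p => (kernel_two p.1 p.2).trans_le (Lambda_sq_le p.1 p.2)) ?_
    rw [integral_one_sub_inner_sq]
    have h2 := le_integral_inner_sq μ
    rw [energy_eq_prod, simplexValue_eq] at h
    linarith
  exact h3.mono fun p hp => orthoParallel_of_Lambda_sq _ _ ((kernel_two p.1 p.2).symm.trans hp)

/-! ### Geometry of points near a frame. -/

/-- The open neighbourhood of radius `θ` of an axis of an orthonormal basis. -/
def Frame.cell (b : Frame d) (θ : ℝ) (i : Fin (d + 1)) : Set (Sph d) :=
  {x | ‖(x : Ambient d) - b i‖ < θ ∨ ‖(x : Ambient d) + b i‖ < θ}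

lemma Frame.isOpen_cell (b : Frame d) (θ : ℝ) (i : Fin (d + 1)) : IsOpen (b.cell θ i) :=
  (isOpen_lt (f := fun x : Sph d => ‖(x : Ambient d) - b i‖) (by fun_prop) continuous_const).union
    (isOpen_lt (f := fun x : Sph d => ‖(x : Ambient d) + b i‖) (by fun_prop) continuous_const)

lemma Frame.axis_subset_cell (b : Frame d) {θ : ℝ} (hθ : 0 < θ) (i : Fin (d + 1)) :
    b.axis i ⊆ b.cell θ i := by
  rintro x (rfl | rfl)
  · left; simpa using hθ
  · right; simpa using hθ

lemma exists_sign_of_mem_cell {b : Frame d} {θ : ℝ} {i : Fin (d + 1)} {x : Sph d}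
    (hx : x ∈ b.cell θ i) : ∃ x' : Sph d, (x' = x ∨ x' = -x) ∧ ‖(x' : Ambient d) - b i‖ < θ := by
  rcases hx with hx | hx
  · exact ⟨x, Or.inl rfl, hx⟩
  · refine ⟨-x, Or.inr rfl, ?_⟩
    have : ((-x : Sph d) : Ambient d) - b i = -((x : Ambient d) + b i) := by
      rw [neg_add, ← sub_eq_add_neg]; rfl
    rwa [this, norm_neg]

lemma norm_le_sum_abs_inner (b : Frame d) (v : Ambient d) :
    ‖v‖ ≤ ∑ j, |inner ℝ v (b j)| := by
  conv_lhs => rw [← b.sum_repr v]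
  refine (norm_sum_le _ _).trans (Finset.sum_le_sum fun j _ => ?_)
  rw [norm_smul, b.orthonormal.1 j, mul_one, Real.norm_eq_abs, b.repr_apply_apply,
    real_inner_comm]

/-- Expand `x - y` in the basis `b`. Its component along `b i` is at most `θ * p`, since `x - y` is
orthogonal to `x + y` and the midpoint is `θ`-close to `b i`. Replacing `b j` by `z j` in the others
costs `θ * p` each. The total error `(d + 1) * θ * p ≤ p / 2` is absorbed on the left. -/
lemma norm_sub_le_of_near {b : Frame d} {θ : ℝ} (hθ : ((d : ℝ) + 1) * θ ≤ 1 / 2)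
    {i : Fin (d + 1)} {x y : Ambient d} (hx1 : ‖x‖ = 1) (hy1 : ‖y‖ = 1) (hx : ‖x - b i‖ < θ)
    (hy : ‖y - b i‖ < θ) {z : Fin (d + 1) → Ambient d} (hz : ∀ j ≠ i, ‖z j - b j‖ < θ) :
    ‖x - y‖ ≤ 2 * ∑ j ∈ Finset.univ.erase i, (|inner ℝ x (z j)| + |inner ℝ y (z j)|) := by
  set p := ‖x - y‖
  have hp : 0 ≤ p := norm_nonneg _
  have hi : |inner ℝ (x - y) (b i)| ≤ θ * p := by
    have h0 : inner ℝ (x - y) (x + y) = 0 := by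
      rw [inner_sub_left, inner_add_right, inner_add_right, real_inner_comm x y,
        real_inner_self_eq_norm_sq, real_inner_self_eq_norm_sq, hx1, hy1]
      ring
    have h1 : inner ℝ (x - y) (b i) = inner ℝ (x - y) (b i - (1 / 2 : ℝ) • (x + y)) := by
      rw [inner_sub_right, inner_smul_right, h0]; ring
    have h2 : b i - (1 / 2 : ℝ) • (x + y)
        = (1 / 2 : ℝ) • (-(x - b i)) + (1 / 2 : ℝ) • (-(y - b i)) := by
      module
    have h3 : ‖b i - (1 / 2 : ℝ) • (x + y)‖ ≤ θ := by
      rw [h2]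
      refine (norm_add_le _ _).trans ?_
      rw [norm_smul, norm_smul, norm_neg, norm_neg, Real.norm_of_nonneg (by norm_num)]
      linarith
    rw [h1]
    calc _ ≤ p * ‖b i - (1 / 2 : ℝ) • (x + y)‖ := abs_real_inner_le_norm _ _
      _ ≤ p * θ := by gcongr
      _ = θ * p := mul_comm _ _
  have hj : ∀ j ≠ i, |inner ℝ (x - y) (b j)|
      ≤ (|inner ℝ x (z j)| + |inner ℝ y (z j)|) + θ * p := by
    intro j hji
    have h1 : inner ℝ (x - y) (b j)
        = inner ℝ x (z j) - inner ℝ y (z j) - inner ℝ (x - y) (z j - b j) := by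
      simp only [inner_sub_right, inner_sub_left]; ring
    have h2 : |inner ℝ (x - y) (z j - b j)| ≤ θ * p := by
      refine (abs_real_inner_le_norm _ _).trans ?_
      rw [mul_comm]
      have := (hz j hji).le
      gcongr
    rw [h1]
    refine (abs_sub _ _).trans (add_le_add (abs_sub _ _) h2)
  have h := norm_le_sum_abs_inner b (x - y)
  rw [← Finset.add_sum_erase _ _ (Finset.mem_univ i)] at h
  have h1 := Finset.sum_le_sum fun j (hj' : j ∈ Finset.univ.erase i) =>
    hj j (Finset.ne_of_mem_erase hj')
  rw [Finset.sum_add_distrib, Finset.sum_const, Finset.card_erase_of_mem (Finset.mem_univ i),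
    Finset.card_univ, Fintype.card_fin, nsmul_eq_mul] at h1
  simp only [add_tsub_cancel_right] at h1
  have h2 : ((d : ℝ) + 1) * θ * p ≤ 1 / 2 * p := by gcongr
  change p ≤ _ at h
  linarith

lemma abs_inner_neg_or {x x' y : Sph d} (h : x' = x ∨ x' = -x) : |⟪x', y⟫| = |⟪x, y⟫| := by
  rcases h with rfl | rfl <;> simp

lemma Lambda_neg_or {x x' y y' : Sph d} (hx : x' = x ∨ x' = -x) (hy : y' = y ∨ y' = -y) :
    Lambda x' y' = Lambda x y := by
  rw [Lambda_eq, Lambda_eq, abs_inner_neg_or hx, real_inner_comm, abs_inner_neg_or hy,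
    real_inner_comm]

lemma Lambda_le_sum_of_mem_cell {b : Frame d} {θ : ℝ} (hθ : ((d : ℝ) + 1) * θ ≤ 1 / 2)
    {i : Fin (d + 1)} {x y : Sph d} (hx : x ∈ b.cell θ i) (hy : y ∈ b.cell θ i)
    {z : Fin (d + 1) → Sph d} (hz : ∀ j, z j ∈ b.cell θ j) :
    Lambda x y ≤ 2 * ∑ j ∈ Finset.univ.erase i, (|⟪x, z j⟫| + |⟪y, z j⟫|) := by
  obtain ⟨x', hx', hxb⟩ := exists_sign_of_mem_cell hx
  obtain ⟨y', hy', hyb⟩ := exists_sign_of_mem_cell hy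
  choose z' hz' hzb using fun j => exists_sign_of_mem_cell (hz j)
  have h := norm_sub_le_of_near hθ (norm_eq_of_mem_sphere x') (norm_eq_of_mem_sphere y') hxb hyb
    fun j _ => hzb j
  have h1 : ∀ j, |⟪x', z' j⟫| + |⟪y', z' j⟫| = |⟪x, z j⟫| + |⟪y, z j⟫| := fun j => by
    rw [abs_inner_neg_or hx', abs_inner_neg_or hy', real_inner_comm, abs_inner_neg_or (hz' j),
      real_inner_comm _ (Subtype.val y), abs_inner_neg_or (hz' j), real_inner_comm,
      real_inner_comm _ (Subtype.val y)]
  rw [Finset.sum_congr rfl fun j _ => h1 j] at h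
  rw [← Lambda_neg_or hx' hy']
  exact (Lambda_le_norm_sub x' y').trans h

lemma Lambda_le_of_mem_cell {b : Frame d} {θ : ℝ} {i : Fin (d + 1)} {x y : Sph d}
    (hx : x ∈ b.cell θ i) (hy : y ∈ b.cell θ i) : Lambda x y ≤ 2 * θ := by
  obtain ⟨x', hx', hxb⟩ := exists_sign_of_mem_cell hx
  obtain ⟨y', hy', hyb⟩ := exists_sign_of_mem_cell hy
  rw [← Lambda_neg_or hx' hy']
  refine (Lambda_le_norm_sub x' y').trans ?_
  have := norm_sub_le_norm_sub_add_norm_sub (x' : Ambient d) (b i) y'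
  rw [norm_sub_rev (b i)] at this
  linarith

lemma abs_inner_le_of_notMem_cell {b : Frame d} {θ : ℝ} (hθ : 0 < θ) {i : Fin (d + 1)} {x : Sph d}
    (hx : x ∉ b.cell θ i) : |⟪x, b.pt i⟫| ≤ 1 - θ ^ 2 / 2 := by
  simp only [Frame.cell, mem_ofPred_eq, not_or, not_lt] at hx
  have h1 := pow_le_pow_left₀ hθ.le hx.1 2
  have h2 := pow_le_pow_left₀ hθ.le hx.2 2
  rw [norm_sub_sq_real, norm_eq_of_mem_sphere, b.orthonormal.1 i] at h1
  rw [norm_add_sq_real, norm_eq_of_mem_sphere, b.orthonormal.1 i] at h2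
  rw [abs_le, Frame.coe_pt]
  constructor <;> linarith

lemma Frame.sum_inner_sq (b : Frame d) (x : Sph d) : ∑ i, ⟪x, b.pt i⟫ ^ 2 = 1 := by
  have := b.sum_sq_norm_inner_left (x : Ambient d)
  simpa [norm_eq_of_mem_sphere] using this

lemma cell_disjoint {b : Frame d} {θ : ℝ} (hθ : θ ≤ 1 / 2) :
    Pairwise (Function.onFun Disjoint (b.cell θ)) := by
  intro i j hij
  refine Set.disjoint_left.2 fun x hi hj => ?_
  -- The threshold `3 / 4` suffices because two squared coordinates above `9 / 16` already exceed
  -- `1`.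
  have key : ∀ k, x ∈ b.cell θ k → 3 / 4 < |⟪x, b.pt k⟫| := by
    intro k hk
    obtain ⟨x', hx', hxb⟩ := exists_sign_of_mem_cell hk
    rw [← abs_inner_neg_or hx']
    have h1 : ‖(x' : Ambient d) - b k‖ ^ 2 < (1 / 2) ^ 2 :=
      pow_lt_pow_left₀ (hxb.trans_le hθ) (norm_nonneg _) two_ne_zero
    rw [norm_sub_sq_real, norm_eq_of_mem_sphere, b.orthonormal.1 k] at h1
    refine lt_of_lt_of_le ?_ (le_abs_self _)
    rw [Frame.coe_pt]
    linarith
  have h := b.sum_inner_sq x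
  have h1 : ∑ k ∈ {i, j}, ⟪x, b.pt k⟫ ^ 2 ≤ ∑ k, ⟪x, b.pt k⟫ ^ 2 :=
    Finset.sum_le_sum_of_subset_of_nonneg (Finset.subset_univ _) fun _ _ _ => sq_nonneg _
  rw [Finset.sum_pair hij, h, ← sq_abs, ← sq_abs ⟪x, b.pt j⟫] at h1
  nlinarith [key i hi, key j hj]

/-! ### First variation of the energy, and exponents below `1`. -/

lemma continuous_integral_left {f : Sph d × Sph d → ℝ} (hf : Continuous f) (μ : Measure (Sph d))
    [IsFiniteMeasure μ] : Continuous fun x => ∫ y, f (x, y) ∂μ := by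
  have := continuous_parametric_integral_of_continuous (μ := μ) (f := fun x y => f (x, y))
    (by exact hf) isCompact_univ
  simpa using this

/-- Moving a fraction of the mass to a point. -/
def addAtom (μ : ProbabilityMeasure (Sph d)) (x : Sph d) (t : ℝ) : Measure (Sph d) :=
  ENNReal.ofReal (1 - t) • (μ : Measure (Sph d)) + ENNReal.ofReal t • Measure.dirac x

lemma isProbabilityMeasure_addAtom (μ : ProbabilityMeasure (Sph d)) (x : Sph d) {t : ℝ}
    (h0 : 0 ≤ t) (h1 : t ≤ 1) : IsProbabilityMeasure (addAtom μ x t) := by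
  constructor
  simp only [addAtom, Measure.add_apply, Measure.smul_apply, measure_univ, smul_eq_mul, mul_one]
  rw [← ENNReal.ofReal_add (by linarith) h0]
  simp

lemma integral_addAtom {μ : ProbabilityMeasure (Sph d)} {x : Sph d} {t : ℝ} (h0 : 0 ≤ t)
    (h1 : t ≤ 1) {f : Sph d → ℝ} (hf : Continuous f) :
    ∫ y, f y ∂(addAtom μ x t) = (1 - t) * ∫ y, f y ∂(μ : Measure (Sph d)) + t * f x := by
  rw [addAtom, integral_add_measure, integral_smul_measure, integral_smul_measure,
    integral_dirac, ENNReal.toReal_ofReal (by linarith), ENNReal.toReal_ofReal h0]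
  · rfl
  · exact (integrable_of_continuous hf).smul_measure ENNReal.ofReal_ne_top
  · exact (integrable_of_continuous hf).smul_measure ENNReal.ofReal_ne_top

lemma kernel_continuous_right {α : ℝ≥0∞} (hα : α ≠ ∞) (x : Sph d) :
    Continuous fun z => kernel α x z :=
  Continuous.comp (g := fun p : Sph d × Sph d => kernel α p.1 p.2) (f := fun z => (x, z))
    (kernel_continuous hα) (by fun_prop)

lemma kernel_continuous_left {α : ℝ≥0∞} (hα : α ≠ ∞) (x : Sph d) :
    Continuous fun z => kernel α z x := by
  rw [show (fun z => kernel α z x) = fun z => kernel α x z from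
    funext fun z => kernel_comm α z x]
  exact kernel_continuous_right hα x

lemma energy_addAtom {α : ℝ≥0∞} (hα' : α ≠ ∞) (μ : ProbabilityMeasure (Sph d)) (x : Sph d)
    {t : ℝ} (h0 : 0 ≤ t) (h1 : t ≤ 1) :
    ∫ y, ∫ z, kernel α z y ∂(addAtom μ x t) ∂(addAtom μ x t)
      = (1 - t) * ((1 - t) * (2 * energy α μ) + t * ∫ z, kernel α x z ∂(μ : Measure (Sph d)))
        + t * ((1 - t) * (∫ z, kernel α x z ∂(μ : Measure (Sph d))) + t * kernel α x x) := by
  have hs : ∀ y : Sph d, Continuous fun z => kernel α z y := kernel_continuous_left hα'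
  have hs' : Continuous fun z => kernel α x z := kernel_continuous_right hα' x
  have h2 : ∀ y, ∫ z, kernel α z y ∂(addAtom μ x t)
      = (1 - t) * ∫ z, kernel α z y ∂(μ : Measure (Sph d)) + t * kernel α x y := fun y =>
    integral_addAtom h0 h1 (hs y)
  have hc1 : Continuous fun y => ∫ z, kernel α z y ∂(μ : Measure (Sph d)) := by
    have h5 : (fun y => ∫ z, kernel α z y ∂(μ : Measure (Sph d)))
        = fun y => ∫ z, kernel α y z ∂(μ : Measure (Sph d)) :=
      funext fun y => integral_congr_ae (ae_of_all _ fun z => kernel_comm α z y)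
    rw [h5]
    exact continuous_integral_left (kernel_continuous hα') _
  have h3 : ∫ z, kernel α z x ∂(μ : Measure (Sph d)) = ∫ z, kernel α x z ∂(μ : Measure (Sph d)) :=
    integral_congr_ae (ae_of_all _ fun z => kernel_comm α z x)
  have h4 : 2 * energy α μ
      = ∫ y, ∫ z, kernel α z y ∂(μ : Measure (Sph d)) ∂(μ : Measure (Sph d)) := by
    rw [energy]; ring
  rw [integral_congr_ae (ae_of_all _ h2), integral_addAtom h0 h1
    (f := fun y => (1 - t) * ∫ z, kernel α z y ∂(μ : Measure (Sph d)) + t * kernel α x y)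
    ((hc1.const_mul _).add (hs'.const_mul _)), h3, h4]
  congr 2
  rw [integral_add (integrable_of_continuous (hc1.const_mul _))
      (integrable_of_continuous (hs'.const_mul _)), integral_const_mul, integral_const_mul]

/-- The left side has derivative `2 * (U - I)` at `t = 0`. The choice `t = (U - I) / 2` makes the
gain explicit. -/
lemma potential_le_of_perturbation {I U k : ℝ} (hI : 0 ≤ I) (hU : U ≤ 1)
    (hk : 0 ≤ k) (h : ∀ t : ℝ, 0 ≤ t → t ≤ 1 →
      (1 - t) * ((1 - t) * I + t * U) + t * ((1 - t) * U + t * k) ≤ I) : U ≤ I := by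
  by_contra hc
  push Not at hc
  have h1 := h ((U - I) / 2) (by linarith) (by linarith)
  set δ := U - I
  have h5 : U = I + δ := by simp [δ]
  have hδ : 0 < δ := by linarith
  rw [h5] at h1
  have h2 : 0 ≤ (δ / 2) ^ 2 * k := by positivity
  have h3 : (1 - δ / 2) * ((1 - δ / 2) * I + δ / 2 * (I + δ)) +
      δ / 2 * ((1 - δ / 2) * (I + δ) + δ / 2 * k) - I
      = δ ^ 2 * (1 - δ / 2 - I / 4) + (δ / 2) ^ 2 * k := by ring
  have h4 : 0 < δ ^ 2 * (1 - δ / 2 - I / 4) := by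
    have : 0 < 1 - δ / 2 - I / 4 := by linarith
    positivity
  linarith

lemma simplexValue_nonneg (d : ℕ) : 0 ≤ simplexValue d := by unfold simplexValue; positivity

lemma simplexValue_lt_one (d : ℕ) : simplexValue d < 1 := by
  rw [simplexValue_eq]
  have : (0 : ℝ) < 1 / ((d : ℝ) + 1) := by positivity
  linarith

/-- First-order optimality of the frame measure when mass is moved to `x`. -/
lemma SimplexMaximizes.potential_le {α : ℝ≥0∞} (hα : 0 < α) (hα' : α ≠ ∞)
    (hm : SimplexMaximizes d α) (b : Frame d) (x : Sph d) :
    ∑ i, kernel α x (b.pt i) ≤ d := by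
  have hU := b.equiOn_prob.potential α x
  have hU1 : ∫ y, kernel α x y ∂(b.prob : Measure (Sph d)) ≤ 1 := by
    rw [hU, div_mul_eq_mul_div, one_mul, div_le_one (by positivity)]
    refine (Finset.sum_le_sum fun i _ => kernel_le_one α x (b.pt i)).trans ?_
    simp
  have h := potential_le_of_perturbation (simplexValue_nonneg d) hU1
    (kernel_nonneg α x x) fun t h0 h1 => by
      have hP := isProbabilityMeasure_addAtom b.prob x h0 h1
      have h2 : 1 / 2 * ∫ y, ∫ z, kernel α z y ∂(addAtom b.prob x t) ∂(addAtom b.prob x t)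
          ≤ 1 / 2 * simplexValue d := hm ⟨addAtom b.prob x t, hP⟩
      rw [energy_addAtom hα' _ _ h0 h1, b.equiOn_prob.energy_eq hα] at h2
      have h3 : 2 * (1 / 2 * simplexValue d) = simplexValue d := by ring
      rw [h3] at h2
      linarith
  rw [hU, simplexValue, div_mul_eq_mul_div, one_mul,
    div_le_div_iff_of_pos_right (by positivity)] at h
  exact h

/-- Below the exponent `1`, the energy is not maximized by the measures equidistributed over an
orthonormal basis. -/
lemma not_simplexMaximizes (hd : 1 ≤ d) {α : ℝ≥0∞} (hα : 0 < α) (hα1 : α < 1) :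
    ¬ SimplexMaximizes d α := by
  intro hm
  let b := stdFrame d
  let i0 : Fin (d + 1) := 0
  let i1 : Fin (d + 1) := ⟨1, by omega⟩
  have hne : i0 ≠ i1 := by simp [i0, i1, Fin.ext_iff]
  have hs : (√2 / 2) ^ 2 = (1 / 2 : ℝ) := by rw [div_pow, Real.sq_sqrt] <;> norm_num
  have hin : ∀ i j, inner ℝ (b i) (b j) = if i = j then (1 : ℝ) else 0 := b.inner_eq_ite
  -- The midpoint has `Λ = 1 / 2` to two basis vectors and `Λ = 1` to the other `d - 1`, so its
  -- kernel sum is `d - 1 + 2 * (1 / 2) ^ α`, above `d` when `α < 1`.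
  let v : Ambient d := (√2 / 2) • (b i0 + b i1)
  have hv : ‖v‖ = 1 := by
    rw [← sq_eq_sq₀ (norm_nonneg _) zero_le_one, one_pow, norm_smul, mul_pow, norm_add_sq_real,
      Real.norm_eq_abs, sq_abs, hs, hin, b.orthonormal.1, b.orthonormal.1, if_neg hne]
    norm_num
  let x : Sph d := ⟨v, by simpa using hv⟩
  have hx : ∀ i, ⟪x, b.pt i⟫ = if i = i0 ∨ i = i1 then √2 / 2 else 0 := by
    intro i
    simp only [x, v, Frame.coe_pt, inner_smul_left, inner_add_left, hin]
    by_cases h0 : i = i0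
    · simp [h0, hne.symm]
    · by_cases h1 : i = i1
      · simp [h1, hne]
      · simp [h0, h1, Ne.symm h0, Ne.symm h1]
  have h := hm.potential_le hα hα1.ne_top b x
  have hL : ∀ i, i = i0 ∨ i = i1 → kernel α x (b.pt i) = (1 / 2) ^ α.toReal := by
    intro i hi
    rw [kernel_of_ne_top hα1.ne_top, Lambda_eq, hx, if_pos hi, abs_of_nonneg (by positivity),
      ← Real.cos_pi_div_four, Real.arccos_cos (by positivity) (by linarith [Real.pi_pos])]
    congr 1
    have := Real.pi_ne_zero
    field_simp
    norm_num
  have hL' : ∀ i ∈ (Finset.univ.erase i0).erase i1, kernel α x (b.pt i) = 1 := by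
    intro i hi
    simp only [Finset.mem_erase, Finset.mem_univ, and_true] at hi
    exact kernel_of_inner_eq_zero _ (by rw [hx, if_neg (by tauto)])
  have hmem : i1 ∈ Finset.univ.erase i0 := by simp [hne.symm]
  rw [← Finset.add_sum_erase _ _ (Finset.mem_univ i0), ← Finset.add_sum_erase _ _ hmem,
    hL _ (Or.inl rfl), hL _ (Or.inr rfl), Finset.sum_congr rfl hL', Finset.sum_const,
    Finset.card_erase_of_mem hmem, Finset.card_erase_of_mem (Finset.mem_univ i0),
    Finset.card_univ, Fintype.card_fin, nsmul_eq_mul, mul_one] at h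
  have h1 : (1 / 2 : ℝ) < (1 / 2) ^ α.toReal := by
    conv_lhs => rw [← Real.rpow_one (1 / 2 : ℝ)]
    refine Real.rpow_lt_rpow_of_exponent_gt (by norm_num) (by norm_num) ?_
    simpa using (ENNReal.toReal_lt_toReal hα1.ne_top ENNReal.one_ne_top).2 hα1
  have h2 : ((d + 1 - 1 - 1 : ℕ) : ℝ) = d - 1 := by
    rw [add_tsub_cancel_right, Nat.cast_sub hd, Nat.cast_one]
  rw [h2] at h
  linarith

/-! ### Energy estimate near a frame. -/

lemma continuous_abs_inner_right (x : Sph d) : Continuous fun z : Sph d => |⟪x, z⟫| := by fun_prop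

/-- The integral of `|x · z|` over the points `z` of a cell. -/
def Frame.cross (b : Frame d) (θ : ℝ) (μ : Measure (Sph d)) (j : Fin (d + 1)) (x : Sph d) : ℝ :=
  ∫ z in b.cell θ j, |⟪x, z⟫| ∂μ

lemma Frame.continuous_cross (b : Frame d) (θ : ℝ) (μ : Measure (Sph d)) [IsFiniteMeasure μ]
    (j : Fin (d + 1)) : Continuous (b.cross θ μ j) :=
  continuous_integral_left (f := fun p : Sph d × Sph d => |⟪p.1, p.2⟫|) (by fun_prop) _

/-- In each cell pick a point `z j` where `|⟪x, z⟫| + |⟪y, z⟫|` is at most its average over the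
cell. The mass bound turns averages into integrals at the cost of a factor `2 * (d + 1)`. -/
lemma Lambda_le_sum_cross {b : Frame d} {θ : ℝ} (hθ : ((d : ℝ) + 1) * θ ≤ 1 / 2)
    {μ : Measure (Sph d)} [IsFiniteMeasure μ]
    (hm : ∀ j, 1 / (2 * ((d : ℝ) + 1)) ≤ μ.real (b.cell θ j)) {i : Fin (d + 1)} {x y : Sph d}
    (hx : x ∈ b.cell θ i) (hy : y ∈ b.cell θ i) :
    Lambda x y ≤ 4 * ((d : ℝ) + 1) *
      ∑ j ∈ Finset.univ.erase i, (b.cross θ μ j x + b.cross θ μ j y) := by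
  have hm0 : ∀ j, 0 < μ.real (b.cell θ j) := fun j => lt_of_lt_of_le (by positivity) (hm j)
  have h1 : ∀ j, ∃ z ∈ b.cell θ j, |⟪x, z⟫| + |⟪y, z⟫|
      ≤ 2 * ((d : ℝ) + 1) * (b.cross θ μ j x + b.cross θ μ j y) := by
    intro j
    have hi : ∀ w : Sph d, Integrable (fun z : Sph d => |⟪w, z⟫|) (μ.restrict (b.cell θ j)) :=
      fun w => integrable_of_continuous (continuous_abs_inner_right w)
    obtain ⟨z, hz, hle⟩ := exists_le_setAverage (μ := μ) (s := b.cell θ j)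
      (f := fun z => |⟪x, z⟫| + |⟪y, z⟫|) (fun h => (hm0 j).ne' (by simp [Measure.real, h]))
      (measure_ne_top _ _) ((hi x).add (hi y))
    refine ⟨z, hz, hle.trans ?_⟩
    rw [setAverage_eq, integral_add (hi x) (hi y), smul_eq_mul]
    have h2 : (μ.real (b.cell θ j))⁻¹ ≤ 2 * ((d : ℝ) + 1) := by
      rw [inv_le_comm₀ (hm0 j) (by positivity), ← one_div]
      exact hm j
    have h3 : 0 ≤ b.cross θ μ j x + b.cross θ μ j y :=
      add_nonneg (integral_nonneg fun z => abs_nonneg _) (integral_nonneg fun z => abs_nonneg _)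
    exact mul_le_mul_of_nonneg_right h2 h3
  choose z hz hle using h1
  refine (Lambda_le_sum_of_mem_cell hθ hx hy hz).trans ?_
  calc _ ≤ 2 * ∑ j ∈ Finset.univ.erase i,
        2 * ((d : ℝ) + 1) * (b.cross θ μ j x + b.cross θ μ j y) := by
        gcongr with j _; exact hle j
    _ = _ := by rw [← Finset.mul_sum]; ring

/-- An exponent bounded away from `1` leaves a spare power of `Λ`, here `√Λ`, which is small in a
small cell. -/
lemma kernel_le_of_mem_cell {b : Frame d} {θ : ℝ} {α : ℝ} (hα : 3 / 2 ≤ α) {i : Fin (d + 1)}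
    {x y : Sph d} (hx : x ∈ b.cell θ i) (hy : y ∈ b.cell θ i) :
    kernel (ENNReal.ofReal α) x y ≤ √(2 * θ) * Lambda x y := by
  have h0 := Lambda_nonneg x y
  rw [kernel_ofReal (by linarith)]
  calc Lambda x y ^ α ≤ Lambda x y ^ (3 / 2 : ℝ) :=
        Real.rpow_le_rpow_of_exponent_ge_of_imp h0 (Lambda_le_one x y) hα
          fun h h' => by linarith
    _ = √(Lambda x y) * Lambda x y := by
        rw [Real.sqrt_eq_rpow, show (3 / 2 : ℝ) = 1 / 2 + 1 by norm_num,
          Real.rpow_add_of_nonneg h0 (by norm_num) zero_le_one, Real.rpow_one]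
    _ ≤ _ := by
        gcongr
        exact Lambda_le_of_mem_cell hx hy

/-- The linear loss that pays for the energy inside the cells; `1 / 2 ≤ 2 / π` as `π ≤ 4`. -/
lemma kernel_le_one_sub {α : ℝ} (hα : 1 ≤ α) (x y : Sph d) :
    kernel (ENNReal.ofReal α) x y ≤ 1 - 1 / 2 * |⟪x, y⟫| := by
  rw [kernel_ofReal (by linarith)]
  have h1 : Lambda x y ^ α ≤ Lambda x y ^ (1 : ℝ) :=
    Real.rpow_le_rpow_of_exponent_ge_of_imp (Lambda_nonneg x y) (Lambda_le_one x y) hα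
      fun h h' => by linarith
  rw [Real.rpow_one] at h1
  refine h1.trans ((Lambda_le_one_sub x y).trans ?_)
  have h2 : 1 / 2 ≤ 2 / Real.pi := by
    rw [div_le_div_iff₀ two_pos Real.pi_pos]
    linarith [Real.pi_le_four]
  have := abs_nonneg ⟪x, y⟫
  gcongr

/-- The integral of `|x · z|` over the pairs of points of two cells. -/
def Frame.crossMass (b : Frame d) (θ : ℝ) (μ : Measure (Sph d)) (i j : Fin (d + 1)) : ℝ :=
  ∫ x in b.cell θ i, b.cross θ μ j x ∂μ

lemma continuous_setIntegral_kernel (α : ℝ) (μ : Measure (Sph d)) [IsFiniteMeasure μ] :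
    Continuous fun x => ∫ z, kernel (ENNReal.ofReal α) x z ∂μ :=
  continuous_integral_left (kernel_continuous ENNReal.ofReal_ne_top) _

lemma integral_cell_cell_le (b : Frame d) (θ : ℝ) {α : ℝ} (hα : 1 ≤ α) (μ : Measure (Sph d))
    [IsFiniteMeasure μ] (i j : Fin (d + 1)) :
    ∫ x in b.cell θ i, ∫ z in b.cell θ j, kernel (ENNReal.ofReal α) x z ∂μ ∂μ
      ≤ μ.real (b.cell θ i) * μ.real (b.cell θ j) - 1 / 2 * b.crossMass θ μ i j := by
  have h1 : ∀ x, ∫ z in b.cell θ j, kernel (ENNReal.ofReal α) x z ∂μ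
      ≤ μ.real (b.cell θ j) - 1 / 2 * b.cross θ μ j x := by
    intro x
    have hi : Integrable (fun z : Sph d => |⟪x, z⟫|) (μ.restrict (b.cell θ j)) :=
      integrable_of_continuous (continuous_abs_inner_right x)
    have h2 := integral_mono (μ := μ.restrict (b.cell θ j)) (kernel_integrable _ x _)
      ((integrable_const (1 : ℝ)).sub (hi.const_mul (1 / 2))) fun z => kernel_le_one_sub hα x z
    refine h2.trans_eq ?_
    rw [integral_sub' (integrable_const _) (hi.const_mul _), integral_const_mul]
    simp [Frame.cross]
  have hc := b.continuous_cross θ μ j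
  have h3 := integral_mono (μ := μ.restrict (b.cell θ i))
    (integrable_of_continuous (continuous_setIntegral_kernel α (μ.restrict (b.cell θ j))))
    (integrable_of_continuous (f := fun x => μ.real (b.cell θ j) - 1 / 2 * b.cross θ μ j x)
      (by fun_prop)) h1
  refine h3.trans_eq ?_
  rw [integral_sub (integrable_const _) (integrable_of_continuous (by fun_prop)),
    integral_const_mul]
  simp [Frame.crossMass]

lemma setIntegral_setIntegral_le_of_le_add {X : Type*} [MeasurableSpace X] {μ : Measure X}
    [IsProbabilityMeasure μ] {C : Set X} (hC : MeasurableSet C) {k : X → X → ℝ} {R : X → ℝ}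
    (hk : ∀ x, IntegrableOn (k x) C μ) (hkk : IntegrableOn (fun x => ∫ y in C, k x y ∂μ) C μ)
    (hR : IntegrableOn R C μ) (hR0 : ∀ x, 0 ≤ R x)
    (h : ∀ x ∈ C, ∀ y ∈ C, k x y ≤ 1 / 4 * (R x + R y)) :
    ∫ x in C, ∫ y in C, k x y ∂μ ∂μ ≤ 1 / 2 * ∫ x in C, R x ∂μ := by
  have hmi : μ.real C ≤ 1 := measureReal_le_one
  set D := ∫ x in C, R x ∂μ
  have hD : 0 ≤ D := integral_nonneg hR0
  have h1 : ∀ x ∈ C, ∫ y in C, k x y ∂μ ≤ 1 / 4 * (R x + D) := by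
    intro x hx
    refine (setIntegral_mono_on (hk x) (((integrable_const (R x)).add hR).const_mul (1 / 4)) hC
      (h x hx)).trans ?_
    rw [integral_const_mul, integral_add' (integrable_const _) hR, setIntegral_const, smul_eq_mul]
    have := mul_le_mul_of_nonneg_right hmi (hR0 x)
    linarith
  refine (setIntegral_mono_on hkk ((hR.add (integrable_const D)).const_mul (1 / 4)) hC h1).trans ?_
  rw [integral_const_mul, integral_add' hR (integrable_const _), setIntegral_const, smul_eq_mul]
  have := mul_le_mul_of_nonneg_right hmi hD
  linarith

lemma kernel_le_sum_cross {b : Frame d} {θ : ℝ} (hθ : ((d : ℝ) + 1) * θ ≤ 1 / 2)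
    (hθ' : 16 * ((d : ℝ) + 1) * √(2 * θ) ≤ 1) {α : ℝ} (hα : 3 / 2 ≤ α)
    {μ : Measure (Sph d)} [IsFiniteMeasure μ]
    (hm : ∀ j, 1 / (2 * ((d : ℝ) + 1)) ≤ μ.real (b.cell θ j)) {i : Fin (d + 1)} {x y : Sph d}
    (hx : x ∈ b.cell θ i) (hy : y ∈ b.cell θ i) :
    kernel (ENNReal.ofReal α) x y ≤ 1 / 4 * (∑ j ∈ Finset.univ.erase i, b.cross θ μ j x
      + ∑ j ∈ Finset.univ.erase i, b.cross θ μ j y) := by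
  have h1 := Lambda_le_sum_cross hθ hm hx hy
  refine (kernel_le_of_mem_cell hα hx hy).trans ?_
  rw [← Finset.sum_add_distrib]
  set S := ∑ j ∈ Finset.univ.erase i, (b.cross θ μ j x + b.cross θ μ j y)
  have h2 : 0 ≤ S := Finset.sum_nonneg fun j _ =>
    add_nonneg (integral_nonneg fun _ => abs_nonneg _) (integral_nonneg fun _ => abs_nonneg _)
  calc √(2 * θ) * Lambda x y ≤ √(2 * θ) * (4 * ((d : ℝ) + 1) * S) := by gcongr
    _ = 1 / 4 * (16 * ((d : ℝ) + 1) * √(2 * θ)) * S := by ring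
    _ ≤ 1 / 4 * 1 * S := by gcongr
    _ = _ := by ring

/-- The right side is exactly the total loss, over `j ≠ i`, in `integral_cell_cell_le`; the two
cancel in `integral_cells_le`. -/
lemma integral_cell_self_le {b : Frame d} {θ : ℝ} (hθ : ((d : ℝ) + 1) * θ ≤ 1 / 2)
    (hθ' : 16 * ((d : ℝ) + 1) * √(2 * θ) ≤ 1) {α : ℝ} (hα : 3 / 2 ≤ α)
    {μ : Measure (Sph d)} [IsProbabilityMeasure μ]
    (hm : ∀ j, 1 / (2 * ((d : ℝ) + 1)) ≤ μ.real (b.cell θ j)) (i : Fin (d + 1)) :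
    ∫ x in b.cell θ i, ∫ y in b.cell θ i, kernel (ENNReal.ofReal α) x y ∂μ ∂μ
      ≤ 1 / 2 * ∑ j ∈ Finset.univ.erase i, b.crossMass θ μ i j := by
  have hint : ∀ j, IntegrableOn (b.cross θ μ j) (b.cell θ i) μ := fun j =>
    integrable_of_continuous (b.continuous_cross θ μ j)
  have h := setIntegral_setIntegral_le_of_le_add (b.isOpen_cell θ i).measurableSet
    (R := fun x => ∑ j ∈ Finset.univ.erase i, b.cross θ μ j x)
    (fun x => kernel_integrable (ENNReal.ofReal α) x (μ.restrict (b.cell θ i)))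
    (integrable_of_continuous (continuous_setIntegral_kernel α (μ.restrict (b.cell θ i))))
    (integrable_finsetSum _ fun j _ => hint j)
    (fun x => Finset.sum_nonneg fun j _ => integral_nonneg fun _ => abs_nonneg _)
    (fun x hx y hy => kernel_le_sum_cross hθ hθ' hα hm hx hy)
  rwa [integral_finsetSum _ fun j _ => hint j] at h

lemma sum_mul_sum_erase_le (m : Fin (d + 1) → ℝ) :
    ∑ i, ∑ j ∈ Finset.univ.erase i, m i * m j ≤ (∑ i, m i) ^ 2 * simplexValue d := by
  have h1 : ∑ i, ∑ j ∈ Finset.univ.erase i, m i * m j = (∑ i, m i) ^ 2 - ∑ i, m i ^ 2 := by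
    rw [pow_two, Finset.sum_mul_sum, ← Finset.sum_sub_distrib]
    refine Finset.sum_congr rfl fun i _ => ?_
    rw [← Finset.add_sum_erase _ _ (Finset.mem_univ i)]
    ring
  have h2 := sq_sum_le_card_mul_sum_sq (s := Finset.univ) (f := m)
  rw [Finset.card_univ, Fintype.card_fin] at h2
  push_cast at h2
  rw [h1, simplexValue_eq, mul_sub, mul_one, mul_one_div]
  have h3 : (∑ i, m i) ^ 2 / ((d : ℝ) + 1) ≤ ∑ i, m i ^ 2 := by
    rw [div_le_iff₀ (by positivity)]
    linarith
  linarith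

lemma integral_cells_le {b : Frame d} {θ : ℝ} (hθ : ((d : ℝ) + 1) * θ ≤ 1 / 2)
    (hθ1 : θ ≤ 1 / 2) (hθ' : 16 * ((d : ℝ) + 1) * √(2 * θ) ≤ 1) {α : ℝ} (hα : 3 / 2 ≤ α)
    {μ : Measure (Sph d)} [IsProbabilityMeasure μ]
    (hm : ∀ j, 1 / (2 * ((d : ℝ) + 1)) ≤ μ.real (b.cell θ j)) :
    ∫ x in ⋃ i, b.cell θ i, ∫ y in ⋃ i, b.cell θ i, kernel (ENNReal.ofReal α) x y ∂μ ∂μ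
      ≤ μ.real (⋃ i, b.cell θ i) ^ 2 * simplexValue d := by
  have hmeas : ∀ i, MeasurableSet (b.cell θ i) := fun i => (b.isOpen_cell θ i).measurableSet
  have hd := cell_disjoint (b := b) hθ1
  have h1 : ∀ x, ∫ y in ⋃ i, b.cell θ i, kernel (ENNReal.ofReal α) x y ∂μ
      = ∑ j, ∫ y in b.cell θ j, kernel (ENNReal.ofReal α) x y ∂μ := fun x =>
    integral_iUnion_fintype hmeas hd fun j => kernel_integrable _ x _
  have hint : ∀ i j, Integrable (fun x => ∫ y in b.cell θ j, kernel (ENNReal.ofReal α) x y ∂μ)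
      (μ.restrict (b.cell θ i)) := fun i j =>
    integrable_of_continuous (continuous_setIntegral_kernel α _)
  rw [integral_congr_ae (ae_of_all _ h1), integral_iUnion_fintype hmeas hd
    fun i => integrable_finsetSum _ fun j _ => hint i j,
    measureReal_iUnion_fintype hd hmeas]
  refine le_trans (Finset.sum_le_sum fun i _ => ?_) (sum_mul_sum_erase_le _)
  rw [integral_finsetSum _ fun j _ => hint i j, ← Finset.add_sum_erase _ _ (Finset.mem_univ i)]
  have h2 := integral_cell_self_le hθ hθ' hα hm i
  have h3 := Finset.sum_le_sum fun j (_ : j ∈ Finset.univ.erase i) =>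
    integral_cell_cell_le b θ (by linarith : 1 ≤ α) μ i j
  rw [Finset.sum_sub_distrib] at h3
  rw [Finset.mul_sum] at h2
  linarith

/-- A measure concentrated near an orthonormal basis, whose potential is smaller than that of the
basis away from the basis, has no more energy than the basis. -/
lemma energy_le_of_near {b : Frame d} {θ : ℝ} (hθ : ((d : ℝ) + 1) * θ ≤ 1 / 2)
    (hθ1 : θ ≤ 1 / 2) (hθ' : 16 * ((d : ℝ) + 1) * √(2 * θ) ≤ 1) {α : ℝ} (hα : 3 / 2 ≤ α)
    {μ : ProbabilityMeasure (Sph d)}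
    (hm : ∀ j, 1 / (2 * ((d : ℝ) + 1)) ≤ (μ : Measure (Sph d)).real (b.cell θ j)) {κ : ℝ}
    (hκ : 1 - 2 * κ ≤ (μ : Measure (Sph d)).real (⋃ i, b.cell θ i))
    (hU : ∀ x ∉ ⋃ i, b.cell θ i, ∫ y, kernel (ENNReal.ofReal α) x y ∂(μ : Measure (Sph d))
      ≤ simplexValue d - κ) :
    energy (ENNReal.ofReal α) μ ≤ 1 / 2 * simplexValue d := by
  set G := ⋃ i, b.cell θ i
  set ν := (μ : Measure (Sph d))
  set K := kernel (d := d) (ENNReal.ofReal α)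
  have hG : MeasurableSet G := (isOpen_iUnion fun i => b.isOpen_cell θ i).measurableSet
  have hKi : ∀ x (σ : Measure (Sph d)) [IsFiniteMeasure σ], Integrable (K x) σ := fun x σ _ =>
    kernel_integrable _ x σ
  have hKc : ∀ (σ τ : Measure (Sph d)) [IsFiniteMeasure σ] [IsFiniteMeasure τ],
      Integrable (fun x => ∫ y, K x y ∂σ) τ := fun σ τ _ _ =>
    integrable_of_continuous (continuous_setIntegral_kernel α σ)
  have h1 := integral_cells_le hθ hθ1 hθ' hα hm
  have hs : ν.real Gᶜ = 1 - ν.real G := probReal_compl_eq_one_sub hG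
  have hB : ∫ x in Gᶜ, ∫ y, K x y ∂ν ∂ν ≤ ν.real Gᶜ * (simplexValue d - κ) := by
    refine (setIntegral_mono_on (hKc _ _) (integrable_const (simplexValue d - κ)) hG.compl
      hU).trans_eq ?_
    rw [setIntegral_const, smul_eq_mul]
  have hswap : ∫ x in G, ∫ y in Gᶜ, K x y ∂ν ∂ν = ∫ x in Gᶜ, ∫ y in G, K x y ∂ν ∂ν := by
    rw [integral_integral_swap (kernel_integrable_prod _ _ _)]
    exact integral_congr_ae (ae_of_all _ fun y =>
      integral_congr_ae (ae_of_all _ fun x => kernel_comm _ x y))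
  have hle : ∫ x in Gᶜ, ∫ y in G, K x y ∂ν ∂ν ≤ ∫ x in Gᶜ, ∫ y, K x y ∂ν ∂ν :=
    integral_mono (hKc _ _) (hKc _ _) fun x =>
      setIntegral_le_integral (hKi x _) (ae_of_all _ fun y => kernel_nonneg _ x y)
  -- Of the three blocks, the mixed one is at most the last by `hswap` and `hle`, whence the factor
  -- `2` in `hfin`.
  have htot : ∫ x, ∫ y, K x y ∂ν ∂ν
      = ∫ x in G, ∫ y in G, K x y ∂ν ∂ν + ∫ x in G, ∫ y in Gᶜ, K x y ∂ν ∂ν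
        + ∫ x in Gᶜ, ∫ y, K x y ∂ν ∂ν := by
    rw [← integral_add_compl hG (hKc ν ν), ← integral_add (hKc _ _) (hKc _ _)]
    congr 1
    exact integral_congr_ae (ae_of_all _ fun x => (integral_add_compl hG (hKi x ν)).symm)
  have hE : energy (ENNReal.ofReal α) μ = 1 / 2 * ∫ x, ∫ y, K x y ∂ν ∂ν := by
    rw [energy_eq_prod, integral_prod _ (kernel_integrable_selfProd _ μ)]
  rw [hE]
  have hI1 := simplexValue_lt_one d
  have hI0 := simplexValue_nonneg d
  rw [hs] at hB
  have hG1 : ν.real G ≤ 1 := measureReal_le_one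
  set g := ν.real G
  -- The right side minus the left is `(1 - g) * (2 * κ - (1 - g) * simplexValue d)`, and `1 - g ≤ 2
  -- * κ`.
  have hfin : g ^ 2 * simplexValue d + 2 * ((1 - g) * (simplexValue d - κ)) ≤ simplexValue d := by
    have h2 : 0 ≤ 1 - g := by linarith
    have h3 : (1 - g) * simplexValue d ≤ (1 - g) * 1 := by gcongr
    have h4 : 0 ≤ (1 - g) * (2 * κ - (1 - g) * simplexValue d) :=
      mul_nonneg h2 (by linarith)
    nlinarith
  change ∫ x in G, ∫ y in G, K x y ∂ν ∂ν ≤ g ^ 2 * simplexValue d at h1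
  linarith

/-! ### Open neighbourhoods of the frame measures. -/

lemma isOpen_setOf_lt_measureReal {X : Type*} [TopologicalSpace X] [MeasurableSpace X]
    [OpensMeasurableSpace X] [HasOuterApproxClosed X] {U : Set X} (hU : IsOpen U) (c : ℝ) :
    IsOpen {μ : ProbabilityMeasure X | c < (μ : Measure X).real U} := by
  rw [isOpen_iff_mem_nhds]
  intro μ hμ
  by_cases hc : c < 0
  · exact Filter.univ_mem' fun ν => hc.trans_le measureReal_nonneg
  push Not at hc
  have h1 : ENNReal.ofReal c < (μ : Measure X) U :=
    (ENNReal.ofReal_lt_iff_lt_toReal hc (measure_ne_top _ _)).2 hμ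
  have h2 := ProbabilityMeasure.le_liminf_measure_open_of_tendsto
    (tendsto_id : Tendsto id (𝓝 μ) (𝓝 μ)) hU
  filter_upwards [eventually_lt_of_lt_liminf (h1.trans_le h2)] with ν hν
  exact (ENNReal.ofReal_lt_iff_lt_toReal hc (measure_ne_top _ _)).1 hν

lemma isOpen_setOf_forall_mem_lt {X Y : Type*} [TopologicalSpace X] [CompactSpace X]
    [TopologicalSpace Y] {F : Set X} (hF : IsClosed F) {g : X × Y → ℝ} (hg : Continuous g)
    (c : ℝ) : IsOpen {y : Y | ∀ x ∈ F, g (x, y) < c} := by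
  rw [← isClosed_compl_iff]
  have h : {y : Y | ∀ x ∈ F, g (x, y) < c}ᶜ = Prod.snd '' {p : X × Y | p.1 ∈ F ∧ c ≤ g p} := by
    ext y
    simp
  rw [h]
  exact isClosedMap_snd_of_compactSpace _
    ((hF.preimage continuous_fst).inter (isClosed_le continuous_const hg))

/-- The kernel of exponent `2` as a bounded continuous function. -/
def kernelTwo (d : ℕ) : BoundedContinuousFunction (Sph d × Sph d) ℝ :=
  BoundedContinuousFunction.mkOfCompact
    ⟨fun p => kernel 2 p.1 p.2, kernel_continuous ENNReal.ofNat_ne_top⟩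

lemma continuous_energy_two : Continuous fun μ : ProbabilityMeasure (Sph d) => energy 2 μ := by
  have h : Continuous fun μ : ProbabilityMeasure (Sph d) =>
      ∫ p, kernelTwo d p ∂((μ.prod μ : ProbabilityMeasure _) : Measure (Sph d × Sph d)) :=
    (ProbabilityMeasure.continuous_integral_boundedContinuousFunction (kernelTwo d)).comp
      (ProbabilityMeasure.continuous_prod.comp (continuous_id.prodMk continuous_id))
  have h2 : (fun μ : ProbabilityMeasure (Sph d) => energy 2 μ) = fun μ =>
      1 / 2 * ∫ p, kernelTwo d p ∂((μ.prod μ : ProbabilityMeasure _) : Measure (Sph d × Sph d)) :=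
    funext fun μ => energy_eq_prod 2 μ
  rw [h2]
  exact h.const_mul _

/-- The potential at `x` is the integral of the kernel against `δ_x ⊗ μ`, which depends continuously
on the pair. -/
lemma continuous_potential_two : Continuous fun p : Sph d × ProbabilityMeasure (Sph d) =>
    ∫ y, kernel 2 p.1 y ∂(p.2 : Measure (Sph d)) := by
  have h : Continuous fun p : Sph d × ProbabilityMeasure (Sph d) =>
      ∫ q, kernelTwo d q
        ∂(((diracProba p.1).prod p.2 : ProbabilityMeasure _) : Measure (Sph d × Sph d)) :=
    (ProbabilityMeasure.continuous_integral_boundedContinuousFunction (kernelTwo d)).comp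
      (ProbabilityMeasure.continuous_prod.comp
        ((continuous_diracProba.comp continuous_fst).prodMk continuous_snd))
  convert h using 2 with p
  have h1 : (((diracProba p.1).prod p.2 : ProbabilityMeasure _) : Measure (Sph d × Sph d))
      = (Measure.dirac p.1).prod (p.2 : Measure (Sph d)) := rfl
  have h2 := integral_prod _ (kernel_integrable_prod 2 (Measure.dirac p.1) (p.2 : Measure (Sph d)))
  rw [integral_dirac] at h2
  rw [h1, ← h2]
  rfl

/-- The measures which concentrate near the axes of an orthonormal basis, and whose potential of
exponent `2` is small away from these axes. -/
def nearFrame (b : Frame d) (θ κ : ℝ) : Set (ProbabilityMeasure (Sph d)) :=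
  {μ | (∀ j, 1 / (2 * ((d : ℝ) + 1)) < (μ : Measure (Sph d)).real (b.cell θ j)) ∧
    1 - κ < (μ : Measure (Sph d)).real (⋃ i, b.cell θ i) ∧
    ∀ x ∈ (⋃ i, b.cell θ i)ᶜ, ∫ y, kernel 2 x y ∂(μ : Measure (Sph d)) < simplexValue d - κ}

lemma isOpen_nearFrame (b : Frame d) (θ κ : ℝ) : IsOpen (nearFrame b θ κ) := by
  have hG : IsOpen (⋃ i, b.cell θ i) := isOpen_iUnion fun i => b.isOpen_cell θ i
  have h1 : IsOpen {μ : ProbabilityMeasure (Sph d) |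
      ∀ j, 1 / (2 * ((d : ℝ) + 1)) < (μ : Measure (Sph d)).real (b.cell θ j)} := by
    rw [ofPred_forall]
    exact isOpen_iInter_of_finite fun j => isOpen_setOf_lt_measureReal (b.isOpen_cell θ j) _
  exact h1.inter ((isOpen_setOf_lt_measureReal hG _).inter
    (isOpen_setOf_forall_mem_lt hG.isClosed_compl continuous_potential_two _))

/-- The kernel sum is `d` minus the sum of the Jordan gaps. Some `|⟪x, b i⟫|` is at least `√(1 / (d
+ 1))`, and outside the cells all are at most `1 - θ² / 2`; the gap has a positive lower bound on
that compact interval, independent of the frame. -/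
lemma exists_jordanGap_bound (d : ℕ) {θ : ℝ} (hθ : 0 < θ) : ∃ κ : ℝ, 0 < κ ∧
    ∀ (b : Frame d) (x : Sph d), x ∉ ⋃ i, b.cell θ i →
      ∑ i, kernel 2 x (b.pt i) ≤ d - κ := by
  obtain ⟨κ, hκ, hle⟩ := (isCompact_Icc (a := √(1 / ((d : ℝ) + 1))) (b := 1 - θ ^ 2 / 2)
    ).exists_forall_le' jordanGap_continuous.continuousOn (a := 0) fun t ht =>
      jordanGap_pos (lt_of_lt_of_le (Real.sqrt_pos.2 (by positivity)) ht.1)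
        (lt_of_le_of_lt ht.2 (by have : 0 < θ ^ 2 := by positivity
                                 linarith))
  refine ⟨κ, hκ, fun b x hx => ?_⟩
  have hsum := b.sum_inner_sq x
  obtain ⟨i, -, hi⟩ : ∃ i ∈ Finset.univ, 1 / ((d : ℝ) + 1) ≤ ⟪x, b.pt i⟫ ^ 2 := by
    refine Finset.exists_le_of_sum_le Finset.univ_nonempty ?_
    rw [hsum, Finset.sum_const, Finset.card_univ, Fintype.card_fin, nsmul_eq_mul]
    push_cast
    field_simp
    exact le_rfl
  have hgap : κ ≤ jordanGap |⟪x, b.pt i⟫| := by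
    refine hle _ ⟨?_, abs_inner_le_of_notMem_cell hθ fun h => hx (mem_iUnion.2 ⟨i, h⟩)⟩
    rw [← Real.sqrt_sq_eq_abs]
    exact Real.sqrt_le_sqrt hi
  have hgap' : κ ≤ ∑ i, jordanGap |⟪x, b.pt i⟫| :=
    hgap.trans (Finset.single_le_sum (f := fun i => jordanGap |⟪x, b.pt i⟫|)
      (fun j _ => by
        have h1 := Lambda_sq_le x (b.pt j)
        rw [Lambda_sq_eq] at h1
        change 0 ≤ jordanGap |⟪x, b.pt j⟫|
        linarith) (Finset.mem_univ i))
  simp_rw [kernel_two, Lambda_sq_eq]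
  rw [Finset.sum_sub_distrib, Finset.sum_sub_distrib, hsum]
  simp only [Finset.sum_const, Finset.card_univ, Fintype.card_fin, nsmul_eq_mul, mul_one]
  push_cast
  linarith

lemma exists_mem_nearFrame (d : ℕ) {θ : ℝ} (hθ : 0 < θ) : ∃ κ : ℝ, 0 < κ ∧
    ∀ (b : Frame d) (μ : ProbabilityMeasure (Sph d)), EquiOn b μ → μ ∈ nearFrame b θ κ := by
  obtain ⟨κ, hκ, h⟩ := exists_jordanGap_bound d hθ
  -- Dividing by `d + 1` passes from the kernel sum to the potential; the extra `2` makes the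
  -- inequality strict.
  refine ⟨κ / (2 * ((d : ℝ) + 1)), by positivity, fun b μ hμ => ⟨fun j => ?_, ?_, fun x hx => ?_⟩⟩
  · refine lt_of_lt_of_le ?_ (measureReal_mono (b.axis_subset_cell hθ j))
    rw [hμ j]
    exact one_div_lt_one_div_of_lt (by positivity) (by linarith)
  · have h1 : (1 : ℝ) ≤ (μ : Measure (Sph d)).real (⋃ i, b.cell θ i) := by
      have h2 : (μ : Measure (Sph d)).real (⋃ i, b.axis i) = 1 := by
        rw [real_iUnion_axis, Finset.sum_congr rfl fun i _ => hμ i]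
        simp
        field_simp
      exact h2.ge.trans <| measureReal_mono (iUnion_mono fun i => b.axis_subset_cell hθ i)
    have : 0 < κ / (2 * ((d : ℝ) + 1)) := by positivity
    linarith
  · rw [hμ.potential]
    have h1 := h b x hx
    have h2 : 1 / ((d : ℝ) + 1) * ∑ i, kernel 2 x (b.pt i) ≤ 1 / ((d : ℝ) + 1) * (d - κ) := by
      gcongr
    refine h2.trans_lt ?_
    have h3 : 1 / ((d : ℝ) + 1) * (d - κ)
        = simplexValue d - κ / (2 * ((d : ℝ) + 1)) - κ / (2 * ((d : ℝ) + 1)) := by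
      rw [simplexValue]; field_simp; ring
    have : 0 < κ / (2 * ((d : ℝ) + 1)) := by positivity
    linarith

/-! ### Lowering the exponent below `2`. -/

/-- Weighted AM–GM for `(t ^ 2) ^ (1 - e) * t ^ e`; the point is uniformity in `t`. -/
lemma rpow_two_sub_le {t e : ℝ} (h0 : 0 ≤ t) (h1 : t ≤ 1) (he0 : 0 ≤ e) (he1 : e ≤ 1) :
    t ^ (2 - e) ≤ t ^ 2 + e := by
  have h := Real.geom_mean_le_arith_mean2_weighted (sub_nonneg.2 he1) he0 (sq_nonneg t) h0
    (by ring)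
  have h2 : (t ^ 2) ^ (1 - e) * t ^ e = t ^ (2 - e) := by
    rw [← Real.rpow_natCast, ← Real.rpow_mul h0, ← Real.rpow_add_of_nonneg h0 _ he0]
    · congr 1; push_cast; ring
    · have : 0 ≤ 1 - e := by linarith
      positivity
  rw [h2] at h
  nlinarith [mul_nonneg he0 (sub_nonneg.2 h1), mul_nonneg he0 (sq_nonneg t)]

lemma kernel_two_sub_le {e : ℝ} (he0 : 0 ≤ e) (he1 : e ≤ 1) (x y : Sph d) :
    kernel (ENNReal.ofReal (2 - e)) x y ≤ kernel 2 x y + e := by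
  rw [kernel_ofReal (by linarith), kernel_two]
  exact rpow_two_sub_le (Lambda_nonneg x y) (Lambda_le_one x y) he0 he1

lemma potential_two_sub_le {e : ℝ} (he0 : 0 ≤ e) (he1 : e ≤ 1) (x : Sph d)
    (μ : ProbabilityMeasure (Sph d)) :
    ∫ y, kernel (ENNReal.ofReal (2 - e)) x y ∂(μ : Measure (Sph d))
      ≤ ∫ y, kernel 2 x y ∂(μ : Measure (Sph d)) + e := by
  refine (integral_mono (kernel_integrable _ x _) ((kernel_integrable 2 x _).add
    (integrable_const e)) fun y => kernel_two_sub_le he0 he1 x y).trans_eq ?_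
  rw [integral_add' (kernel_integrable 2 x _) (integrable_const e)]
  simp

lemma energy_two_sub_le {e : ℝ} (he0 : 0 ≤ e) (he1 : e ≤ 1) (μ : ProbabilityMeasure (Sph d)) :
    energy (ENNReal.ofReal (2 - e)) μ ≤ energy 2 μ + e := by
  have h := integral_mono (kernel_integrable_selfProd (ENNReal.ofReal (2 - e)) μ)
    ((kernel_integrable_selfProd 2 μ).add (integrable_const e))
    fun p => kernel_two_sub_le he0 he1 p.1 p.2
  rw [integral_add' (kernel_integrable_selfProd 2 μ) (integrable_const e)] at h
  simp only [integral_const, probReal_univ, smul_eq_mul, one_mul] at h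
  rw [energy_eq_prod, energy_eq_prod]
  linarith

/-- The measures equidistributed over an orthonormal basis still maximize the energy for some
exponent below `2`. -/
lemma exists_simplexMaximizes_lt_two (d : ℕ) :
    ∃ α : ℝ≥0∞, 0 < α ∧ α < 2 ∧ SimplexMaximizes d α := by
  obtain ⟨θ, hθ0, hθ, hθ1, hθ'⟩ : ∃ θ : ℝ, 0 < θ ∧ ((d : ℝ) + 1) * θ ≤ 1 / 2 ∧ θ ≤ 1 / 2 ∧
      16 * ((d : ℝ) + 1) * √(2 * θ) ≤ 1 := by
    have hN : (1 : ℝ) ≤ (d : ℝ) + 1 := by simp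
    set N : ℝ := (d : ℝ) + 1
    have hN2 : (1 : ℝ) ≤ N ^ 2 := one_le_pow₀ hN
    -- Chosen so that `√(2 * θ) = 1 / (16 * N)`, equality in the last constraint.
    refine ⟨1 / (512 * N ^ 2), by positivity, ?_, ?_, ?_⟩
    · rw [mul_one_div, div_le_div_iff₀ (by positivity) two_pos]
      nlinarith
    · rw [div_le_div_iff₀ (by positivity) two_pos]
      nlinarith
    · have : 2 * (1 / (512 * N ^ 2)) = (1 / (16 * N)) ^ 2 := by field_simp; norm_num
      rw [this, Real.sqrt_sq (by positivity)]
      field_simp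
      exact le_rfl
  obtain ⟨κ, hκ, hnear⟩ := exists_mem_nearFrame d hθ0
  have hopen : IsOpen (⋃ b : Frame d, nearFrame b θ κ) :=
    isOpen_iUnion fun b => isOpen_nearFrame b θ κ
  -- The complement of the neighbourhoods is compact and contains no maximizer of `E_2`, so `E_2 ≤
  -- -c` there, with gap `c + simplexValue d / 2 > 0`.
  obtain ⟨c, hc, hcle⟩ := hopen.isClosed_compl.isCompact.exists_forall_le'
    (f := fun μ : ProbabilityMeasure (Sph d) => -energy 2 μ)
    continuous_energy_two.neg.continuousOn (a := -(1 / 2 * simplexValue d)) fun μ hμ => by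
      by_contra hle
      push Not at hle
      obtain ⟨b, hb⟩ := mem_of_le_energy_two (neg_le_neg_iff.1 hle)
      exact hμ (mem_iUnion.2 ⟨b, hnear b μ hb⟩)
  -- The three bounds keep the exponent at least `3 / 2`, leave half of the potential gap `κ`, and
  -- stay within the energy gap.
  obtain ⟨e, he0, he1, heκ, hec⟩ : ∃ e : ℝ, 0 < e ∧ e ≤ 1 / 2 ∧ e ≤ κ / 2 ∧
      e ≤ c + 1 / 2 * simplexValue d := by
    refine ⟨min (1 / 2) (min (κ / 2) (c + 1 / 2 * simplexValue d)), ?_, min_le_left _ _,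
      (min_le_right _ _).trans (min_le_left _ _), (min_le_right _ _).trans (min_le_right _ _)⟩
    have : 0 < c + 1 / 2 * simplexValue d := by linarith
    positivity
  refine ⟨ENNReal.ofReal (2 - e), ENNReal.ofReal_pos.2 (by linarith), ?_, fun μ => ?_⟩
  · rw [ENNReal.ofReal_lt_iff_lt_toReal (by linarith) ENNReal.ofNat_ne_top]
    simpa using he0
  by_cases hμ : μ ∈ ⋃ b : Frame d, nearFrame b θ κ
  · obtain ⟨b, hm, hG, hU⟩ := mem_iUnion.1 hμ
    refine energy_le_of_near hθ hθ1 hθ' (by linarith) (fun j => (hm j).le) (κ := κ / 2)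
      (by linarith) fun x hx => ?_
    have h1 := potential_two_sub_le he0.le (by linarith) x μ
    have h2 := hU x hx
    linarith
  · have h1 := energy_two_sub_le he0.le (by linarith) μ
    have h2 := hcle μ hμ
    linarith

/-! ### The threshold exponent. -/

lemma disjoint_argmax {α : ℝ≥0∞} (hα : 0 < α) (hm : ¬ SimplexMaximizes d α) :
    Disjoint (simplexEqMeasures d) (argmaxEnergy d α) := by
  rw [Set.disjoint_left]
  intro μ hμ hμ'
  refine hm fun ν => ?_
  rw [← energy_of_mem hμ hα]
  exact hμ' ν

/-- The threshold exponent, as the infimum of the exponents for which the measures equidistributed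
over an orthonormal basis maximize the energy. -/
def threshold (d : ℕ) : ℝ≥0∞ := sInf {α | 0 < α ∧ SimplexMaximizes d α}

lemma threshold_lt_two (d : ℕ) : threshold d < 2 := by
  obtain ⟨α, h0, h2, hm⟩ := exists_simplexMaximizes_lt_two d
  exact (sInf_le (a := α) (s := {α | 0 < α ∧ SimplexMaximizes d α}) ⟨h0, hm⟩).trans_lt h2

lemma one_le_threshold (hd : 1 ≤ d) : 1 ≤ threshold d := by
  refine le_sInf fun α hα => ?_
  by_contra h
  exact not_simplexMaximizes hd hα.1 (not_le.1 h) hα.2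

lemma isThresholdExponent_threshold (d : ℕ) : IsThresholdExponent d (threshold d) := by
  refine ⟨fun α hα h => disjoint_argmax hα fun hm => ?_, fun α h => ?_⟩
  · exact h.not_ge (sInf_le (a := α) (s := {α | 0 < α ∧ SimplexMaximizes d α}) ⟨hα, hm⟩)
  · obtain ⟨β, ⟨hβ, hm⟩, hlt⟩ := sInf_lt_iff.1 h
    exact hm.argmax_eq hβ hlt

/-- At an exponent strictly between two thresholds, the nonempty set `simplexEqMeasures d` would be
both equal to and disjoint from the set of maximizers. -/
lemma IsThresholdExponent.le {a a' : ℝ≥0∞} (h : IsThresholdExponent d a)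
    (h' : IsThresholdExponent d a') : a ≤ a' := by
  by_contra hlt
  obtain ⟨α, h1, h2⟩ := exists_between (not_le.1 hlt)
  have hd := h.1 α (zero_le.trans_lt h1) h2
  rw [← h'.2 α h1, disjoint_self] at hd
  exact (simplexEqMeasures_nonempty d).ne_empty hd

lemma IsThresholdExponent.eq_threshold {a : ℝ≥0∞} (h : IsThresholdExponent d a) :
    a = threshold d :=
  le_antisymm (h.le (isThresholdExponent_threshold d)) ((isThresholdExponent_threshold d).le h)

lemma essEquiv_of_mem {μ ν : ProbabilityMeasure (Sph d)} (hμ : μ ∈ simplexEqMeasures d)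
    (hν : ν ∈ simplexEqMeasures d) : EssEquiv μ ν := by
  obtain ⟨b, hb⟩ := (mem_simplexEqMeasures_iff _).1 hμ
  obtain ⟨c, hc⟩ := (mem_simplexEqMeasures_iff _).1 hν
  exact hb.essEquiv hc

end

end ProjectiveEnergy

theorem corollary3p6 (d : ℕ) (hd : 1 ≤ d) :
    (∃! a : ℝ≥0∞, ProjectiveEnergy.IsThresholdExponent d a) ∧
    (∀ a : ℝ≥0∞, ProjectiveEnergy.IsThresholdExponent d a → 1 ≤ a ∧ a < 2) ∧
    (∃ ε : ℝ, 0 < ε ∧ ∀ α : ℝ, 2 - ε < α → α < 2 →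
      ProjectiveEnergy.argmaxEnergy d (ENNReal.ofReal α) = ProjectiveEnergy.simplexEqMeasures d ∧
      (ProjectiveEnergy.argmaxEnergy d (ENNReal.ofReal α)).Nonempty ∧
      ∀ μ ∈ ProjectiveEnergy.argmaxEnergy d (ENNReal.ofReal α),
        ∀ ν ∈ ProjectiveEnergy.argmaxEnergy d (ENNReal.ofReal α),
          ProjectiveEnergy.EssEquiv μ ν) := by
  have ht := ProjectiveEnergy.isThresholdExponent_threshold d
  have h2 := ProjectiveEnergy.threshold_lt_two d
  refine ⟨⟨_, ht, fun a ha => ha.eq_threshold⟩, fun a ha => ?_, ?_⟩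
  · rw [ha.eq_threshold]
    exact ⟨ProjectiveEnergy.one_le_threshold hd, h2⟩
  · refine ⟨2 - (ProjectiveEnergy.threshold d).toReal, ?_, fun α hα _ => ?_⟩
    · have := (ENNReal.toReal_lt_toReal h2.ne_top ENNReal.ofNat_ne_top).2 h2
      simpa using this
    · have hlt : ProjectiveEnergy.threshold d < ENNReal.ofReal α := by
        rw [ENNReal.lt_ofReal_iff_toReal_lt h2.ne_top]
        linarith
      rw [← ht.2 _ hlt]
      exact ⟨rfl, ProjectiveEnergy.simplexEqMeasures_nonempty d, fun μ hμ ν hν =>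
        ProjectiveEnergy.essEquiv_of_mem hμ hν⟩
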